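/- Let $\alpha_1,\alpha_2,\alpha_3,\beta$ be the $4\times4$ Dirac matrices in standard representation, and let $\mathcal H=\mathbb C^{16}\otimes L^2(\mathbb R^3)$ with $\mathbb C^{16}=\mathbb C^4\otimes\mathbb C^4$. Put $M^-_k=\alpha_k\otimes\mathbf 1_4-\mathbf 1_4\otimes\alpha_k$ for $k=1,2,3$ and $B=2\,\beta\otimes\beta$. Let $\hat p=-i\nabla$, and let $M^-\cdot\hat p=\sum_k M^-_k\hat p_k$ act in $\mathcal H$ on its maximal domain. For $p\in\mathbb R^3\setminus\{0\}$ let $$\tau(p)=-\frac{(\alpha\cdot p)\otimes(\alpha\cdot p)}{|p|^2},$$ let $\tau$ be the corresponding Fourier multiplier on $\mathcal H$, and let $P_+=\frac12(\mathrm{id}+\tau)$, $\mathcal H_+=P_+\mathcal H$ and $D_+=(\mathbb C^{16}\otimes H^1(\mathbb R^3))\cap\mathcal H_+$. Here $P_+$ is an orthogonal projection, and $M^-\cdot\hat p$ and $B$ map (the part of their domain in) $\mathcal H_+$ into $\mathcal H_+$. Let $0<\kappa\le 1$, $\gamma\in\mathbb R$, let $V$ be the operator of multiplication by $|r|^{-\kappa}$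 in $\mathcal H$ on its maximal domain, and let $$M_\kappa=2^{-\kappa}\,\frac{\Gamma\left(\frac34-\frac\kappa2\right)}{\Gamma\left(\frac34+\frac\kappa2\right)}.$$ If $|\gamma|M_\kappa<2$, then the operator $$A=M^-\cdot\hat p+BP_++P_+\gamma VP_+$$ is well defined on $D_+$, and, as an operator in the Hilbert space $\mathcal H_+$ with domain $D(A)=D_+$, (a) $A$ is self-adjoint, and (b) $0$ belongs to the resolvent set of $A$, i.e. $A\colon D_+\to\mathcal H_+$ is bijective with bounded inverse. -/

import Mathlib

open MeasureTheory Matrix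
open scoped Kronecker ENNReal

noncomputable section

namespace TwoBodyDirac

/-! ### Dirac matrices -/

/-- The Pauli matrices `σ₁, σ₂, σ₃`. -/
def pauli : Fin 3 → Matrix (Fin 2) (Fin 2) ℂ
  | 0 => !![0, 1; 1, 0]
  | 1 => !![0, -Complex.I; Complex.I, 0]
  | 2 => !![1, 0; 0, -1]

/-- Index set of the four components of a one-particle spinor (two blocks of length two). -/
abbrev Idx4 : Type := Fin 2 ⊕ Fin 2

/-- Index set of the sixteen components of a two-particle spinor. -/
abbrev Idx16 : Type := Idx4 × Idx4

/-- The Dirac matrices `α₁, α₂, α₃` in standard representation. -/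
def dAlpha (k : Fin 3) : Matrix Idx4 Idx4 ℂ :=
  Matrix.fromBlocks 0 (pauli k) (pauli k) 0

/-- The Dirac matrix `β` in standard representation. -/
def dBeta : Matrix Idx4 Idx4 ℂ :=
  Matrix.fromBlocks 1 0 0 (-1)

/-- The three-dimensional Euclidean space, used for positions and momenta. -/
abbrev R3 : Type := EuclideanSpace ℝ (Fin 3)

/-- `ℂ¹⁶ = ℂ⁴ ⊗ ℂ⁴` with its Hermitian inner product. -/
abbrev Spin : Type := EuclideanSpace ℂ Idx16

/-- A `16 × 16` matrix as an operator on `ℂ¹⁶`. -/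
def act (M : Matrix Idx16 Idx16 ℂ) : Spin →L[ℂ] Spin :=
  Matrix.toEuclideanCLM (𝕜 := ℂ) M

/-- The matrix `α · p`. -/
def alphaDot (p : R3) : Matrix Idx4 Idx4 ℂ :=
  ∑ k, ((p k : ℝ) : ℂ) • dAlpha k

/-- The coefficient matrices `M⁻ₖ = αₖ ⊗ 1 - 1 ⊗ αₖ`. -/
def Mminus (k : Fin 3) : Matrix Idx16 Idx16 ℂ :=
  dAlpha k ⊗ₖ (1 : Matrix Idx4 Idx4 ℂ) - (1 : Matrix Idx4 Idx4 ℂ) ⊗ₖ dAlpha k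

/-- The matrix `M⁻ · p`. -/
def MminusDot (p : R3) : Matrix Idx16 Idx16 ℂ :=
  ∑ k, ((p k : ℝ) : ℂ) • Mminus k

/-- The matrix `B = 2 β ⊗ β`. -/
def matB : Matrix Idx16 Idx16 ℂ :=
  (2 : ℂ) • (dBeta ⊗ₖ dBeta)

/-- The matrix `τ(p) = - (α · p) ⊗ (α · p) / |p|²` (its value at `p = 0` is irrelevant). -/
def tauMat (p : R3) : Matrix Idx16 Idx16 ℂ :=
  -((((‖p‖ ^ 2)⁻¹ : ℝ) : ℂ) • (alphaDot p ⊗ₖ alphaDot p))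

/-! ### Matrix identities needed for the definitions -/

lemma alphaDot_sq (p : R3) :
    alphaDot p * alphaDot p = (((‖p‖ ^ 2 : ℝ)) : ℂ) • (1 : Matrix Idx4 Idx4 ℂ) := by
  rw [EuclideanSpace.norm_sq_eq]
  have hI := Complex.I_mul_I
  ext i j
  rcases i with i | i <;> rcases j with j | j <;> fin_cases i <;> fin_cases j <;>
    simp [alphaDot, dAlpha, pauli, Matrix.mul_apply, Fin.sum_univ_three] <;>
    first
    | done
    | ring1
    | linear_combination (- (p 1 : ℂ) ^ 2) * hI

lemma alphaDot_conjTranspose (p : R3) : (alphaDot p)ᴴ = alphaDot p := by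
  ext i j
  rcases i with i | i <;> rcases j with j | j <;> fin_cases i <;> fin_cases j <;>
    simp [alphaDot, dAlpha, pauli, Fin.sum_univ_three, Matrix.conjTranspose_apply]

lemma alphaDot_anticomm (p : R3) : alphaDot p * dBeta = -(dBeta * alphaDot p) := by
  ext i j
  rcases i with i | i <;> rcases j with j | j <;> fin_cases i <;> fin_cases j <;>
    simp [alphaDot, dAlpha, dBeta, pauli, Matrix.mul_apply, Fin.sum_univ_three]

lemma MminusDot_eq (p : R3) :
    MminusDot p = alphaDot p ⊗ₖ (1 : Matrix Idx4 Idx4 ℂ) -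
      (1 : Matrix Idx4 Idx4 ℂ) ⊗ₖ alphaDot p := by
  simp only [MminusDot, Mminus, alphaDot, Fin.sum_univ_three, Matrix.add_kronecker,
    Matrix.kronecker_add, Matrix.smul_kronecker, Matrix.kronecker_smul, smul_sub]
  abel

lemma tauMat_sq {p : R3} (hp : p ≠ 0) : tauMat p * tauMat p = 1 := by
  have h : (‖p‖ : ℂ) ≠ 0 := by simpa using hp
  simp only [tauMat, neg_mul_neg, smul_mul_smul_comm, ← Matrix.mul_kronecker_mul, alphaDot_sq,
    Matrix.smul_kronecker, Matrix.kronecker_smul, Matrix.one_kronecker_one, smul_smul]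
  push_cast
  rw [show ((‖p‖ : ℂ) ^ 2)⁻¹ * ((‖p‖ : ℂ) ^ 2)⁻¹ * ((‖p‖ : ℂ) ^ 2 * (‖p‖ : ℂ) ^ 2) = 1 by
    field_simp, one_smul]

lemma tauMat_conjTranspose (p : R3) : (tauMat p)ᴴ = tauMat p := by
  simp only [tauMat, Matrix.conjTranspose_neg, Matrix.conjTranspose_smul,
    Matrix.conjTranspose_kronecker, alphaDot_conjTranspose]
  simp

lemma tauMat_mul_MminusDot {p : R3} (hp : p ≠ 0) : tauMat p * MminusDot p = MminusDot p := by
  have h : (‖p‖ : ℂ) ≠ 0 := by simpa using hp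
  rw [MminusDot_eq]
  simp only [tauMat, neg_mul, smul_mul_assoc, mul_sub, ← Matrix.mul_kronecker_mul, alphaDot_sq,
    mul_one, Matrix.smul_kronecker, Matrix.kronecker_smul, smul_smul]
  push_cast
  rw [inv_mul_cancel₀ (pow_ne_zero 2 h)]
  simp only [one_smul]
  abel

lemma tauMat_mul_matB (p : R3) : tauMat p * matB = matB * tauMat p := by
  simp only [tauMat, matB, neg_mul, mul_neg, smul_mul_smul_comm, ← Matrix.mul_kronecker_mul,
    alphaDot_anticomm]
  congr 1
  rw [mul_comm]
  congr 1
  ext i j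
  simp [Matrix.kroneckerMap_apply]

lemma act_mul (M N : Matrix Idx16 Idx16 ℂ) (v : Spin) : act (M * N) v = act M (act N v) := by
  simp [act, map_mul]

lemma act_one (v : Spin) : act 1 v = v := by
  simp [act, map_one]

lemma norm_act_tauMat_le (p : R3) : ‖act (tauMat p)‖ ≤ 1 := by
  by_cases hp : p = 0
  · subst hp
    simp [tauMat, act]
  · have h1 : star (act (tauMat p)) * act (tauMat p) = 1 := by
      rw [act, ← map_star, ← map_mul, Matrix.star_eq_conjTranspose, tauMat_conjTranspose,
        tauMat_sq hp, map_one]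
    have h2 := CStarRing.norm_star_mul_self (x := act (tauMat p))
    rw [h1] at h2
    have h3 : ‖(1 : Spin →L[ℂ] Spin)‖ ≤ 1 := ContinuousLinearMap.norm_id_le
    nlinarith [norm_nonneg (act (tauMat p))]

lemma measurable_alphaDot (i j : Idx4) : Measurable fun p : R3 => alphaDot p i j := by
  simp only [alphaDot, Fin.sum_univ_three, Matrix.add_apply, Matrix.smul_apply]
  fun_prop

lemma aestronglyMeasurable_act_tauMat {f : R3 → Spin} (hf : AEStronglyMeasurable f volume) :
    AEStronglyMeasurable (fun p => act (tauMat p) (f p)) volume := by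
  have hm : ∀ i j, Measurable fun p : R3 => tauMat p i j := by
    intro i j
    simp only [tauMat, Matrix.neg_apply, Matrix.smul_apply, Matrix.kroneckerMap_apply]
    have h1 := measurable_alphaDot i.1 j.1
    have h2 := measurable_alphaDot i.2 j.2
    simp only [smul_eq_mul]
    fun_prop
  have hc : ∀ j, AEMeasurable (fun p => f p j) volume := fun j =>
    (EuclideanSpace.proj (𝕜 := ℂ) j).continuous.measurable.comp_aemeasurable hf.aemeasurable
  have he : (fun p => act (tauMat p) (f p)) =
      fun p => WithLp.toLp 2 (fun i => ∑ j, tauMat p i j * f p j) := by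
    funext p
    rfl
  rw [he]
  refine AEMeasurable.aestronglyMeasurable ?_
  refine (WithLp.measurable_toLp 2 _).comp_aemeasurable (aemeasurable_pi_lambda _ fun i => ?_)
  exact Finset.aemeasurable_fun_sum _ fun j _ => (hm i j).aemeasurable.mul (hc j)

/-! ### The Hilbert space, the Fourier transform and multiplication operators -/

/-- The Hilbert space `ℂ¹⁶ ⊗ L²(ℝ³)` of the relative coordinate, i.e. the `ℂ¹⁶`-valued
square integrable functions on `ℝ³`. -/
abbrev Hrel : Type := Lp Spin 2 (volume : Measure R3)

/-- The unitary Fourier transform on `Hrel`, with kernel `exp (-2 π i r · p)`. Thus the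
operator `-i ∂ₖ` is multiplication by `2 π pₖ` in Fourier space. -/
def fourierRel : Hrel ≃ₗᵢ[ℂ] Hrel := Lp.fourierTransformₗᵢ R3 Spin

lemma ae_map_add (m : R3 → Spin →L[ℂ] Spin) (f g : Hrel) :
    (fun r => m r ((f + g : Hrel) r)) =ᵐ[volume] (fun r => m r (f r)) + fun r => m r (g r) := by
  filter_upwards [Lp.coeFn_add f g] with r hr
  rw [hr, Pi.add_apply, map_add, Pi.add_apply]

lemma ae_map_smul (m : R3 → Spin →L[ℂ] Spin) (c : ℂ) (f : Hrel) :
    (fun r => m r ((c • f : Hrel) r)) =ᵐ[volume] c • fun r => m r (f r) := by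
  filter_upwards [Lp.coeFn_smul c f] with r hr
  rw [hr, Pi.smul_apply, map_smul, Pi.smul_apply]

lemma ae_map_zero (m : R3 → Spin →L[ℂ] Spin) :
    (fun r => m r ((0 : Hrel) r)) =ᵐ[volume] fun _ => (0 : Spin) := by
  filter_upwards [Lp.coeFn_zero Spin 2 (volume : Measure R3)] with r hr
  rw [hr, Pi.zero_apply, map_zero]

/-- The domain `{f ∈ Hrel | m f ∈ Hrel}` of multiplication by an operator-valued function `m`. -/
def mulDomain (m : R3 → Spin →L[ℂ] Spin) : Submodule ℂ Hrel where
  carrier := {f | MemLp (fun r => m r (f r)) 2 volume}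
  add_mem' := fun {f g} hf hg => (memLp_congr_ae (ae_map_add m f g)).mpr (MemLp.add hf hg)
  zero_mem' := (memLp_congr_ae (ae_map_zero m)).mpr MemLp.zero'
  smul_mem' := fun c f hf => (memLp_congr_ae (ae_map_smul m c f)).mpr (MemLp.const_smul hf c)

lemma memLp_of_mem_mulDomain {m : R3 → Spin →L[ℂ] Spin} {f : Hrel} (hf : f ∈ mulDomain m) :
    MemLp (fun r => m r (f r)) 2 volume := hf

/-- The maximal operator of multiplication by an operator-valued function `m`. -/
def mulOp (m : R3 → Spin →L[ℂ] Spin) : Hrel →ₗ.[ℂ] Hrel where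
  domain := mulDomain m
  toFun :=
    { toFun := fun f => (memLp_of_mem_mulDomain f.2).toLp _
      map_add' := fun f g =>
        (MemLp.toLp_congr _ ((memLp_of_mem_mulDomain f.2).add (memLp_of_mem_mulDomain g.2))
          (ae_map_add m f g)).trans (MemLp.toLp_add _ _)
      map_smul' := fun c f =>
        (MemLp.toLp_congr _ ((memLp_of_mem_mulDomain f.2).const_smul c)
          (ae_map_smul m c f)).trans (MemLp.toLp_const_smul _ _) }

lemma mulOp_coeFn {m : R3 → Spin →L[ℂ] Spin} (f : (mulOp m).domain) :
    mulOp m f =ᵐ[volume] fun r => m r ((f : Hrel) r) :=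
  (memLp_of_mem_mulDomain f.2).coeFn_toLp

/-- The maximal Fourier multiplier `𝓕⁻¹ m 𝓕`, with domain `{f ∈ Hrel | m (𝓕 f) ∈ Hrel}`. -/
def fourierMulOp (m : R3 → Spin →L[ℂ] Spin) : Hrel →ₗ.[ℂ] Hrel where
  domain := (mulOp m).domain.comap (fourierRel.toLinearEquiv : Hrel →ₗ[ℂ] Hrel)
  toFun :=
    { toFun := fun f => fourierRel.symm (mulOp m ⟨fourierRel f, f.2⟩)
      map_add' := by
        intro f g
        rw [← map_add, ← LinearPMap.map_add]
        congr 2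
        ext1
        simp
      map_smul' := by
        intro c f
        rw [RingHom.id_apply, ← map_smul, ← LinearPMap.map_smul]
        congr 2
        ext1
        simp }

/-- The free relative operator `M⁻ · p̂` with `p̂ = -i ∇`, on its maximal domain
`{f ∈ Hrel | M⁻ · p̂ f ∈ Hrel}`. -/
def freeRel : Hrel →ₗ.[ℂ] Hrel :=
  fourierMulOp fun p => act (MminusDot ((2 * Real.pi) • p))

/-- The operator `V` of multiplication by `|r|^(-κ)`, on its maximal domain. -/
def potV (κ : ℝ) : Hrel →ₗ.[ℂ] Hrel :=
  mulOp fun r => ((‖r‖ ^ (-κ) : ℝ) : ℂ) • ContinuousLinearMap.id ℂ Spin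

/-- The bounded operator of multiplication by the constant matrix `B = 2 β ⊗ β`. -/
def opB : Hrel →L[ℂ] Hrel := (act matB).compLpL 2 volume

lemma memLp_tauMat (f : Hrel) : MemLp (fun p => act (tauMat p) (f p)) 2 volume := by
  refine (Lp.memLp f).of_le (aestronglyMeasurable_act_tauMat (Lp.aestronglyMeasurable f)) ?_
  exact Filter.Eventually.of_forall fun p =>
    ((act (tauMat p)).le_of_opNorm_le (norm_act_tauMat_le p) _).trans_eq (one_mul _)

/-- Multiplication by the matrix-valued function `τ(p)`, as a bounded operator. -/
def mulTau : Hrel →L[ℂ] Hrel :=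
  LinearMap.mkContinuous
    { toFun := fun f => (memLp_tauMat f).toLp _
      map_add' := fun f g =>
        (MemLp.toLp_congr _ ((memLp_tauMat f).add (memLp_tauMat g))
          (ae_map_add _ f g)).trans (MemLp.toLp_add _ _)
      map_smul' := fun c f =>
        (MemLp.toLp_congr _ ((memLp_tauMat f).const_smul c)
          (ae_map_smul _ c f)).trans (MemLp.toLp_const_smul _ _) } 1
    (by
      intro f
      rw [one_mul]
      refine Lp.norm_le_norm_of_ae_le ?_
      filter_upwards [(memLp_tauMat f).coeFn_toLp] with p hp
      simp only [LinearMap.coe_mk, AddHom.coe_mk, hp]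
      exact ((act (tauMat p)).le_of_opNorm_le (norm_act_tauMat_le p) _).trans_eq (one_mul _))

lemma mulTau_coeFn (f : Hrel) : mulTau f =ᵐ[volume] fun p => act (tauMat p) (f p) :=
  (memLp_tauMat f).coeFn_toLp

lemma ae_ne_zero : ∀ᵐ p : R3 ∂volume, p ≠ 0 := by
  simp [ae_iff]

lemma mulTau_mulTau (f : Hrel) : mulTau (mulTau f) = f := by
  refine Lp.ext ?_
  filter_upwards [mulTau_coeFn (mulTau f), mulTau_coeFn f, ae_ne_zero] with p h1 h2 hp
  rw [h1, h2, ← act_mul, tauMat_sq hp, act_one]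

/-! ### The projection `P₊` and its range -/

/-- The operator `τ = 𝓕⁻¹ τ(p) 𝓕`. -/
def opTau : Hrel →L[ℂ] Hrel :=
  (fourierRel.symm.toContinuousLinearEquiv : Hrel →L[ℂ] Hrel) ∘L mulTau ∘L
    (fourierRel.toContinuousLinearEquiv : Hrel →L[ℂ] Hrel)

lemma opTau_apply (f : Hrel) : opTau f = fourierRel.symm (mulTau (fourierRel f)) := rfl

lemma opTau_opTau (f : Hrel) : opTau (opTau f) = f := by
  simp [opTau_apply, mulTau_mulTau]

/-- The projection `P₊ = (id + τ) / 2`. -/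
def Pplus : Hrel →L[ℂ] Hrel := (1 / 2 : ℂ) • (ContinuousLinearMap.id ℂ Hrel + opTau)

lemma Pplus_apply (f : Hrel) : Pplus f = (1 / 2 : ℂ) • (f + opTau f) := rfl

/-- The closed subspace `P₊ Hrel`. -/
def Hplus : Submodule ℂ Hrel := LinearMap.range (Pplus : Hrel →ₗ[ℂ] Hrel)

lemma Pplus_mem (f : Hrel) : Pplus f ∈ Hplus := ⟨f, rfl⟩

lemma mem_Hplus_iff (f : Hrel) : f ∈ Hplus ↔ opTau f = f := by
  constructor
  · rintro ⟨g, rfl⟩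
    rw [ContinuousLinearMap.coe_coe, Pplus_apply, map_smul, map_add, opTau_opTau,
      add_comm (opTau g) g]
  · intro h
    refine ⟨f, ?_⟩
    rw [ContinuousLinearMap.coe_coe, Pplus_apply, h, ← two_smul ℂ f, smul_smul]
    norm_num

lemma isClosed_Hplus : IsClosed (Hplus : Set Hrel) := by
  have h : (Hplus : Set Hrel) = {f | opTau f = f} := Set.ext mem_Hplus_iff
  rw [h]
  exact isClosed_eq opTau.continuous continuous_id

instance : CompleteSpace Hplus := isClosed_Hplus.completeSpace_coe

lemma freeRel_mem (f : freeRel.domain) : freeRel f ∈ Hplus := by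
  rw [mem_Hplus_iff, opTau_apply]
  set g : (mulOp fun p => act (MminusDot ((2 * Real.pi) • p))).domain :=
    ⟨fourierRel f, f.2⟩ with hg
  have hf : freeRel f = fourierRel.symm (mulOp _ g) := rfl
  rw [hf, LinearIsometryEquiv.apply_symm_apply]
  congr 1
  refine Lp.ext ?_
  filter_upwards [mulTau_coeFn (mulOp _ g), mulOp_coeFn g, ae_ne_zero] with p h0 h1 hp
  have h2 : MminusDot ((2 * Real.pi) • p) = ((2 * Real.pi : ℝ) : ℂ) • MminusDot p := by
    simp only [MminusDot, Finset.smul_sum, smul_smul]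
    refine Finset.sum_congr rfl fun k _ => ?_
    congr 1
    simp
  have h3 : tauMat p * MminusDot ((2 * Real.pi) • p) = MminusDot ((2 * Real.pi) • p) := by
    rw [h2, mul_smul_comm, tauMat_mul_MminusDot hp]
  rw [h0, h1, ← act_mul, h3]

lemma opB_coeFn (f : Hrel) : opB f =ᵐ[volume] fun r => act matB (f r) :=
  (act matB).coeFn_compLpL f

lemma fourierRel_opB (f : Hrel) : fourierRel (opB f) = opB (fourierRel f) := by
  have hd := SchwartzMap.denseRange_toLpCLM (E := R3) (F := Spin) (p := 2)
    (μ := (volume : Measure R3)) ENNReal.ofNat_ne_top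
  refine congrFun (hd.equalizer (fourierRel.continuous.comp opB.continuous)
    (opB.continuous.comp fourierRel.continuous) ?_) f
  funext u
  have hB : ∀ v : SchwartzMap R3 Spin,
      opB (v.toLp 2) = (SchwartzMap.postcompCLM (act matB) v).toLp 2 := by
    intro v
    refine Lp.ext ?_
    filter_upwards [opB_coeFn (v.toLp 2), v.coeFn_toLp 2,
      (SchwartzMap.postcompCLM (act matB) v).coeFn_toLp 2] with r h1 h2 h3
    rw [h1, h2, h3]
    rfl
  have hF : ∀ v : SchwartzMap R3 Spin,
      fourierRel (v.toLp 2) = (FourierTransform.fourier v).toLp 2 :=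
    fun v => SchwartzMap.toLp_fourier_eq v
  change fourierRel (opB (u.toLp 2)) = opB (fourierRel (u.toLp 2))
  rw [hB, hF, hF, hB]
  congr 1
  ext1 w
  change FourierTransform.fourier (fun r => act matB (u r)) w
    = act matB (FourierTransform.fourier (u : R3 → Spin) w)
  rw [Real.fourier_eq, Real.fourier_eq, ← ContinuousLinearMap.integral_comp_comm]
  · simp [Circle.smul_def]
  · exact (Real.fourierIntegral_convergent_iff w).mpr u.integrable

lemma mulTau_opB (f : Hrel) : mulTau (opB f) = opB (mulTau f) := by
  refine Lp.ext ?_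
  filter_upwards [mulTau_coeFn (opB f), opB_coeFn f, opB_coeFn (mulTau f), mulTau_coeFn f]
    with p h1 h2 h3 h4
  rw [h1, h2, h3, h4, ← act_mul, ← act_mul, tauMat_mul_matB]

lemma opB_mem {f : Hrel} (hf : f ∈ Hplus) : opB f ∈ Hplus := by
  rw [mem_Hplus_iff, opTau_apply] at hf ⊢
  rw [fourierRel_opB, mulTau_opB, LinearIsometryEquiv.symm_apply_eq, fourierRel_opB]
  congr 1
  rwa [LinearIsometryEquiv.symm_apply_eq] at hf

/-! ### The operator `A` -/

/-- The Sobolev space `ℂ¹⁶ ⊗ H¹(ℝ³)` as a subspace of `Hrel`. -/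
def sobolevOne : Submodule ℂ Hrel where
  carrier := {f | TemperedDistribution.MemSobolev 1 2 (f : TemperedDistribution R3 Spin)}
  add_mem' := by
    intro f g hf hg
    have h := TemperedDistribution.MemSobolev.add hf hg
    rw [← Lp.toTemperedDistributionCLM_apply, ← Lp.toTemperedDistributionCLM_apply,
      ← map_add] at h
    exact h
  zero_mem' := by
    have h := TemperedDistribution.memSobolev_fun_zero R3 Spin 1 2
    rw [← map_zero (Lp.toTemperedDistributionCLM Spin (volume : Measure R3) 2)] at h
    exact h
  smul_mem' := by
    intro c f hf
    have h := TemperedDistribution.MemSobolev.smul c hf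
    rw [← Lp.toTemperedDistributionCLM_apply, ← map_smul] at h
    exact h

/-- `D₊ = (ℂ¹⁶ ⊗ H¹(ℝ³)) ∩ P₊ Hrel`, as a subspace of the Hilbert space `P₊ Hrel`. -/
def Dplus : Submodule ℂ Hplus := sobolevOne.comap Hplus.subtype

/-- The elements of `D₊` on which each term of `A` is defined. -/
def domA (κ : ℝ) : Submodule ℂ Hplus :=
  Dplus ⊓ freeRel.domain.comap Hplus.subtype ⊓
    (potV κ).domain.comap ((Pplus : Hrel →ₗ[ℂ] Hrel) ∘ₗ Hplus.subtype)

/-- The operator `A = M⁻ · p̂ + B P₊ + P₊ γ V P₊` in the Hilbert space `P₊ Hrel`, defined on those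
elements of `D₊` on which each of its terms is defined. -/
def opA (κ γ : ℝ) : Hplus →ₗ.[ℂ] Hplus where
  domain := domA κ
  toFun :=
    { toFun := fun f =>
        ⟨freeRel ⟨((f : Hplus) : Hrel), f.2.1.2⟩ + opB (Pplus ((f : Hplus) : Hrel)) +
            Pplus ((γ : ℂ) • potV κ ⟨Pplus ((f : Hplus) : Hrel), f.2.2⟩),
          add_mem (add_mem (freeRel_mem _) (opB_mem (Pplus_mem _))) (Pplus_mem _)⟩
      map_add' := by
        intro f g
        have h1 : freeRel ⟨(((f + g : domA κ) : Hplus) : Hrel), (f + g).2.1.2⟩ =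
            freeRel ⟨((f : Hplus) : Hrel), f.2.1.2⟩ + freeRel ⟨((g : Hplus) : Hrel), g.2.1.2⟩ :=
          freeRel.map_add ⟨((f : Hplus) : Hrel), f.2.1.2⟩ ⟨((g : Hplus) : Hrel), g.2.1.2⟩
        have h0 : Pplus (((f + g : domA κ) : Hplus) : Hrel) =
            Pplus ((f : Hplus) : Hrel) + Pplus ((g : Hplus) : Hrel) := map_add Pplus _ _
        have h2 : potV κ ⟨Pplus (((f + g : domA κ) : Hplus) : Hrel), (f + g).2.2⟩ =
            potV κ ⟨Pplus ((f : Hplus) : Hrel), f.2.2⟩ +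
              potV κ ⟨Pplus ((g : Hplus) : Hrel), g.2.2⟩ := by
          rw [← LinearPMap.map_add]
          exact congrArg (potV κ) (Subtype.ext h0)
        refine Subtype.ext ?_
        change freeRel _ + opB _ + Pplus _ = (freeRel _ + opB _ + Pplus _) +
          (freeRel _ + opB _ + Pplus _)
        rw [h1, h2, h0, map_add, smul_add, map_add]
        abel
      map_smul' := by
        intro c f
        have h1 : freeRel ⟨(((c • f : domA κ) : Hplus) : Hrel), (c • f).2.1.2⟩ =
            c • freeRel ⟨((f : Hplus) : Hrel), f.2.1.2⟩ :=
          freeRel.map_smul c ⟨((f : Hplus) : Hrel), f.2.1.2⟩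
        have h0 : Pplus (((c • f : domA κ) : Hplus) : Hrel) = c • Pplus ((f : Hplus) : Hrel) :=
          map_smul Pplus _ _
        have h2 : potV κ ⟨Pplus (((c • f : domA κ) : Hplus) : Hrel), (c • f).2.2⟩ =
            c • potV κ ⟨Pplus ((f : Hplus) : Hrel), f.2.2⟩ := by
          rw [← LinearPMap.map_smul]
          exact congrArg (potV κ) (Subtype.ext h0)
        refine Subtype.ext ?_
        change freeRel _ + opB _ + Pplus _ = c • (freeRel _ + opB _ + Pplus _)
        rw [h1, h2, h0, map_smul, smul_comm (γ : ℂ) c, map_smul, smul_add, smul_add] }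

/-- The resolvent set of an (unbounded) operator `T` in `H`: those `z` for which `T - z` is a
bijection of the domain of `T` onto `H` with bounded inverse `R`. -/
def resolventSet {H : Type*} [NormedAddCommGroup H] [NormedSpace ℂ H] (T : H →ₗ.[ℂ] H) : Set ℂ :=
  {z | ∃ R : H →L[ℂ] H,
    (∀ x : H, ∃ h : R x ∈ T.domain, T ⟨R x, h⟩ - z • R x = x) ∧
    ∀ y : T.domain, R (T y - z • (y : H)) = y}

/-- The constant `M_κ = 2^(-κ) Γ(3/4 - κ/2) / Γ(3/4 + κ/2)`. -/
def constM (κ : ℝ) : ℝ :=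
  (2 : ℝ) ^ (-κ) * Real.Gamma (3 / 4 - κ / 2) / Real.Gamma (3 / 4 + κ / 2)

end TwoBodyDirac

end

/-!
The theorem is a Kato–Rellich argument made quantitative by two identities in Fourier space.

Let `S(p) = M⁻ · (2 π p) + B` be the symbol of the operator without potential. Since `M⁻ · p` and
`B` anticommute, `B² = 4` and `(M⁻ · p)² = 2 |p|² (1 + τ(p))`, one has
`S(p)² = 4 (1 + |2 π p|²)` on the range of `(1 + τ(p)) / 2` (`act_sym_act_sym`). As `S(p)` is
Hermitian and commutes with `τ(p)`, the operator `A₀` without potential is a symmetric bijection of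
`D₊` onto `P₊ Hrel`, and `‖A₀ f‖ = 2 ‖(1 - Δ)^(1/2) f‖`
(`exists_freeRel_add_opB_eq`, `norm_le_half_norm_freeRel_add_opB`).

Herbst's inequality `‖ |x|^(-κ) f ‖ ≤ M_κ ‖ |2 π p|^κ 𝓕 f ‖` (`herbst_schwartz`, `herbst`) then
bounds the potential term by `|γ| M_κ / 2 < 1` times `‖A₀ f‖`, because
`|2 π p|^κ ≤ (1 + |2 π p|²)^(1/2)` for `κ ≤ 1`. Hence `A = (1 + K) A₀` with `‖K‖ < 1`, so `A` is
bijective with bounded inverse, and a symmetric operator onto the whole space is self-adjoint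
(`isSelfAdjoint_and_zero_mem_resolventSet`).

The sharp constant in Herbst's inequality comes from a Schur test in Fourier space. Writing
`|x|^(-2κ)` as a superposition of Gaussians, whose Fourier transforms are heat kernels, bounds the
left-hand side by the form `∬ |𝓕 f(p)| |𝓕 f(q)| |p - q|^(2κ - 3)` up to a constant
(`lintegral_gaussian_mul_le`). The arithmetic-geometric mean inequality with the weight
`|p|^(-(3 + 2κ) / 2)` reduces this form to a convolution of two Riesz kernels
(`lintegral_lintegral_mul_riesz_le`), which the semigroup law of the heat kernel turns into a beta
integral (`lintegral_riesz_mul_riesz`); the constant of the test is exactly `M_κ²`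
(`beta_mul_riesz_div_riesz`).
-/

noncomputable section

namespace TwoBodyDirac

/-! ### Heat kernels and Riesz kernels on `ℝ³` -/

/-- The heat kernel on `ℝ³`, with the time scaled so that `heat t` is the Fourier transform of
`x ↦ exp (-π² t |x|²)`. -/
def heat (t : ℝ) (x : R3) : ℝ :=
  (Real.pi * t) ^ (-(3 / 2) : ℝ) * Real.exp (-‖x‖ ^ 2 / t)

lemma heat_nonneg {t : ℝ} (ht : 0 < t) (x : R3) : 0 ≤ heat t x := by
  unfold heat; positivity

lemma heat_neg (t : ℝ) (x : R3) : heat t (-x) = heat t x := by simp [heat]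

@[fun_prop]
lemma measurable_heat : Measurable fun z : ℝ × R3 => heat z.1 z.2 := by
  unfold heat; fun_prop

lemma lintegral_exp_neg_mul_sq_norm {b : ℝ} (hb : 0 < b) :
    ∫⁻ v : R3, ENNReal.ofReal (Real.exp (-b * ‖v‖ ^ 2)) =
      ENNReal.ofReal ((Real.pi / b) ^ (3 / 2 : ℝ)) := by
  have h := GaussianFourier.integral_rexp_neg_mul_sq_norm (V := R3) hb
  rw [finrank_euclideanSpace_fin] at h
  norm_num at h
  have hi : Integrable fun v : R3 => Real.exp (-b * ‖v‖ ^ 2) := by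
    by_contra hc
    simp only [neg_mul] at hc
    rw [integral_undef hc] at h
    have : 0 < (Real.pi / b) ^ (3 / 2 : ℝ) := by positivity
    linarith
  rw [← ofReal_integral_eq_lintegral_ofReal hi (ae_of_all _ fun _ => (Real.exp_pos _).le)]
  simp only [neg_mul]
  rw [h]

/-- The semigroup law of the heat kernel. -/
lemma lintegral_heat_mul_heat {t u : ℝ} (ht : 0 < t) (hu : 0 < u) (p : R3) :
    ∫⁻ q, ENNReal.ofReal (heat t (p - q)) * ENNReal.ofReal (heat u q) =
      ENNReal.ofReal (heat (t + u) p) := by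
  set b : ℝ := (t + u) / (t * u) with hb
  set D : ℝ := (Real.pi * t) ^ (-(3 / 2) : ℝ) * (Real.pi * u) ^ (-(3 / 2) : ℝ) *
    Real.exp (-‖p‖ ^ 2 / (t + u)) with hD
  have hbpos : 0 < b := by positivity
  have hpt : ∀ q : R3, ENNReal.ofReal (heat t (p - q)) * ENNReal.ofReal (heat u q) =
      ENNReal.ofReal D * ENNReal.ofReal (Real.exp (-b * ‖q - (u / (t + u)) • p‖ ^ 2)) := by
    intro q
    rw [← ENNReal.ofReal_mul (heat_nonneg ht _), ← ENNReal.ofReal_mul (by positivity)]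
    congr 1
    simp only [heat, hD]
    have e : -‖p - q‖ ^ 2 / t + -‖q‖ ^ 2 / u =
        -‖p‖ ^ 2 / (t + u) + -b * ‖q - (u / (t + u)) • p‖ ^ 2 := by
      rw [norm_sub_sq_real, norm_sub_sq_real, norm_smul, inner_smul_right, real_inner_comm q p,
        mul_pow, Real.norm_eq_abs, sq_abs, hb]
      field_simp
      ring
    have e' := congrArg Real.exp e
    rw [Real.exp_add, Real.exp_add] at e'
    linear_combination (Real.pi * t) ^ (-(3 / 2) : ℝ) * (Real.pi * u) ^ (-(3 / 2) : ℝ) * e'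
  simp_rw [hpt]
  rw [lintegral_const_mul _ (by fun_prop),
    lintegral_sub_right_eq_self (fun q : R3 => ENNReal.ofReal (Real.exp (-b * ‖q‖ ^ 2))),
    lintegral_exp_neg_mul_sq_norm hbpos, ← ENNReal.ofReal_mul (by positivity)]
  congr 1
  have hpi := Real.pi_pos
  have e : Real.pi / b = (Real.pi * t) * (Real.pi * u) * (Real.pi * (t + u))⁻¹ := by
    rw [hb]; field_simp
  rw [e, Real.mul_rpow (by positivity) (by positivity), Real.mul_rpow (by positivity)
    (by positivity), hD, heat, Real.inv_rpow (by positivity),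
    Real.rpow_neg (by positivity : 0 ≤ Real.pi * t), Real.rpow_neg (by positivity),
    Real.rpow_neg (by positivity)]
  field_simp

/-- The beta integral over `(0, s)`. -/
lemma lintegral_rpow_mul_sub_rpow {x y s : ℝ} (hx : 0 < x) (hy : 0 < y) (hs : 0 < s) :
    ∫⁻ t in Set.Ioo 0 s, ENNReal.ofReal (t ^ (y - 1) * (s - t) ^ (x - 1)) =
      ENNReal.ofReal (ProbabilityTheory.beta y x * s ^ (x + y - 1)) := by
  have h1 := ProbabilityTheory.lintegral_betaPDF_eq_one hy hx
  rw [ProbabilityTheory.lintegral_betaPDF] at h1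
  have himg : (fun r : ℝ => s * r) '' Set.Ioo 0 1 = Set.Ioo 0 s := by
    rw [Set.image_mul_left_Ioo hs, mul_zero, mul_one]
  have hB := ProbabilityTheory.beta_pos hy hx
  rw [← himg, lintegral_image_eq_lintegral_abs_deriv_mul (f' := fun _ => s) measurableSet_Ioo
    (fun r _ => by simpa using ((hasDerivAt_id r).const_mul s).hasDerivWithinAt)
    (fun a _ b _ h => mul_left_cancel₀ hs.ne' h)]
  have : ∀ r ∈ Set.Ioo (0 : ℝ) 1, ENNReal.ofReal |s| *
      ENNReal.ofReal ((s * r) ^ (y - 1) * (s - s * r) ^ (x - 1)) =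
      ENNReal.ofReal (ProbabilityTheory.beta y x * s ^ (x + y - 1)) *
        ENNReal.ofReal (1 / ProbabilityTheory.beta y x * r ^ (y - 1) * (1 - r) ^ (x - 1)) := by
    rintro r ⟨hr0, hr1⟩
    rw [← ENNReal.ofReal_mul (abs_nonneg s), ← ENNReal.ofReal_mul (by positivity)]
    congr 1
    rw [show s - s * r = s * (1 - r) by ring, Real.mul_rpow hs.le hr0.le,
      Real.mul_rpow hs.le (by linarith), abs_of_pos hs,
      show x + y - 1 = 1 + (y - 1) + (x - 1) by ring, Real.rpow_add hs, Real.rpow_add hs,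
      Real.rpow_one]
    field_simp
  rw [setLIntegral_congr_fun measurableSet_Ioo this, lintegral_const_mul _ (by fun_prop), h1,
    mul_one]

/-- Integrating a function of `t + u` against `t ^ (y - 1) u ^ (x - 1)` produces a beta factor. -/
lemma lintegral_lintegral_rpow_add {x y : ℝ} (hx : 0 < x) (hy : 0 < y) {F : ℝ → ℝ≥0∞}
    (hF : Measurable F) :
    ∫⁻ t in Set.Ioi 0, ∫⁻ u in Set.Ioi 0, ENNReal.ofReal (t ^ (y - 1) * u ^ (x - 1)) * F (t + u) =
      ENNReal.ofReal (ProbabilityTheory.beta y x) *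
        ∫⁻ s in Set.Ioi 0, ENNReal.ofReal (s ^ (x + y - 1)) * F s := by
  set k : ℝ → ℝ → ℝ≥0∞ := fun t s => (Set.Ioi (0 : ℝ)).indicator 1 t *
    ((Set.Ioi (0 : ℝ)).indicator 1 (s - t) *
      (ENNReal.ofReal (t ^ (y - 1) * (s - t) ^ (x - 1)) * F s)) with hk
  have hind : Measurable ((Set.Ioi (0 : ℝ)).indicator (1 : ℝ → ℝ≥0∞)) :=
    measurable_one.indicator measurableSet_Ioi
  have hkm : Measurable (Function.uncurry k) := by
    simp only [hk, Function.uncurry_def]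
    fun_prop
  have h1 : ∀ t, (Set.Ioi (0 : ℝ)).indicator 1 t * ∫⁻ u in Set.Ioi 0,
      ENNReal.ofReal (t ^ (y - 1) * u ^ (x - 1)) * F (t + u) = ∫⁻ s, k t s := by
    intro t
    simp only [hk]
    rw [lintegral_const_mul _ (by fun_prop), ← lintegral_indicator measurableSet_Ioi,
      ← lintegral_sub_right_eq_self _ t]
    congr 2
    funext s
    by_cases h : s - t ∈ Set.Ioi (0 : ℝ)
    · simp [Set.indicator_of_mem h]
    · simp [Set.indicator_of_notMem h]
  have h2 : ∀ s, ∫⁻ t, k t s = (Set.Ioi (0 : ℝ)).indicator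
      (fun s => ENNReal.ofReal (ProbabilityTheory.beta y x) *
        (ENNReal.ofReal (s ^ (x + y - 1)) * F s)) s := by
    intro s
    have h3 : ∀ t, k t s = (Set.Ioo 0 s).indicator
        (fun t => ENNReal.ofReal (t ^ (y - 1) * (s - t) ^ (x - 1)) * F s) t := by
      intro t
      simp only [hk, Set.indicator_apply, Set.mem_Ioi, Set.mem_Ioo, sub_pos]
      by_cases h0 : 0 < t <;> by_cases h1 : t < s <;> simp [h0, h1]
    simp_rw [h3]
    rw [lintegral_indicator measurableSet_Ioo, lintegral_mul_const _ (by fun_prop)]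
    by_cases hs : 0 < s
    · rw [lintegral_rpow_mul_sub_rpow hx hy hs, Set.indicator_of_mem (Set.mem_Ioi.mpr hs),
        ENNReal.ofReal_mul (ProbabilityTheory.beta_pos hy hx).le, mul_assoc]
    · rw [Set.Ioo_eq_empty hs, Set.indicator_of_notMem (by simpa using hs)]
      simp
  calc _ = ∫⁻ t, ∫⁻ s, k t s := by
        rw [← lintegral_indicator measurableSet_Ioi]
        refine lintegral_congr fun t => ?_
        rw [← h1 t]
        by_cases h : t ∈ Set.Ioi (0 : ℝ)
        · simp [Set.indicator_of_mem h]
        · simp [Set.indicator_of_notMem h]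
    _ = ∫⁻ s, ∫⁻ t, k t s := lintegral_lintegral_swap hkm.aemeasurable
    _ = _ := by
        simp_rw [h2]
        rw [lintegral_indicator measurableSet_Ioi, lintegral_const_mul _ (by fun_prop)]

/-- The Riesz kernel, a multiple of `|p| ^ (2 x - 3)`, as a superposition of heat kernels. -/
def riesz (x : ℝ) (p : R3) : ℝ≥0∞ :=
  ∫⁻ t in Set.Ioi 0, ENNReal.ofReal (t ^ (x - 1)) * ENNReal.ofReal (heat t p)

@[fun_prop]
lemma measurable_riesz (x : ℝ) : Measurable (riesz x) := by
  unfold riesz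
  apply Measurable.lintegral_prod_right'
    (f := fun z : R3 × ℝ => ENNReal.ofReal (z.2 ^ (x - 1)) * ENNReal.ofReal (heat z.2 z.1))
  fun_prop

lemma riesz_neg (x : ℝ) (p : R3) : riesz x (-p) = riesz x p := by
  simp only [riesz, heat_neg]

/-- Riesz kernels form a convolution semigroup up to a beta factor. -/
lemma lintegral_riesz_mul_riesz {x y : ℝ} (hx : 0 < x) (hy : 0 < y) (p : R3) :
    ∫⁻ q, riesz y (p - q) * riesz x q =
      ENNReal.ofReal (ProbabilityTheory.beta y x) * riesz (x + y) p := by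
  have h1 : ∀ q, riesz y (p - q) * riesz x q = ∫⁻ t in Set.Ioi 0, ∫⁻ u in Set.Ioi 0,
      ENNReal.ofReal (t ^ (y - 1) * u ^ (x - 1)) *
        (ENNReal.ofReal (heat t (p - q)) * ENNReal.ofReal (heat u q)) := by
    intro q
    simp only [riesz]
    rw [← lintegral_lintegral_mul (by fun_prop) (by fun_prop)]
    refine setLIntegral_congr_fun measurableSet_Ioi fun t ht => ?_
    refine setLIntegral_congr_fun measurableSet_Ioi fun u hu => ?_
    have := Set.mem_Ioi.mp ht
    rw [ENNReal.ofReal_mul (by positivity)]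
    ring
  simp_rw [h1]
  have hm : ∀ t : ℝ, Measurable fun z : R3 × ℝ => ENNReal.ofReal (t ^ (y - 1) * z.2 ^ (x - 1)) *
        (ENNReal.ofReal (heat t (p - z.1)) * ENNReal.ofReal (heat z.2 z.1)) := by
    intro t; fun_prop
  rw [lintegral_lintegral_swap]
  · rw [riesz, ← lintegral_lintegral_rpow_add hx hy (F := fun t => ENNReal.ofReal (heat t p))
      (by fun_prop)]
    refine setLIntegral_congr_fun measurableSet_Ioi fun t ht => ?_
    rw [lintegral_lintegral_swap (hm t).aemeasurable]
    refine setLIntegral_congr_fun measurableSet_Ioi fun u hu => ?_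
    rw [lintegral_const_mul _ (by fun_prop), lintegral_heat_mul_heat ht hu]
  · refine Measurable.aemeasurable ?_
    apply Measurable.lintegral_prod_right'
      (f := fun z : (R3 × ℝ) × ℝ => ENNReal.ofReal (z.1.2 ^ (y - 1) * z.2 ^ (x - 1)) *
        (ENNReal.ofReal (heat z.1.2 (p - z.1.1)) * ENNReal.ofReal (heat z.2 z.1.1)))
    fun_prop

/-- The gamma integral, with values in `ℝ≥0∞`. -/
lemma lintegral_rpow_mul_exp_neg_mul {a r : ℝ} (ha : 0 < a) (hr : 0 < r) :
    ∫⁻ t in Set.Ioi 0, ENNReal.ofReal (t ^ (a - 1) * Real.exp (-(r * t))) =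
      ENNReal.ofReal (r ^ (-a) * Real.Gamma a) := by
  have h := Real.integral_rpow_mul_exp_neg_mul_Ioi ha hr
  have hG := Real.Gamma_pos_of_pos ha
  have hi : IntegrableOn (fun t : ℝ => t ^ (a - 1) * Real.exp (-(r * t))) (Set.Ioi 0) := by
    by_contra hc
    rw [integral_undef hc] at h
    have : 0 < (1 / r) ^ a * Real.Gamma a := by positivity
    linarith
  rw [← ofReal_integral_eq_lintegral_ofReal hi, h]
  · rw [one_div, Real.inv_rpow hr.le, Real.rpow_neg hr.le]
  · filter_upwards [ae_restrict_mem measurableSet_Ioi] with t ht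
    have := Set.mem_Ioi.mp ht
    positivity

/-- The closed form of the Riesz kernel. -/
lemma riesz_eq {x : ℝ} (hx : x < 3 / 2) {p : R3} (hp : p ≠ 0) :
    riesz x p = ENNReal.ofReal
      (Real.pi ^ (-(3 / 2) : ℝ) * (‖p‖ ^ (2 * x - 3) * Real.Gamma (3 / 2 - x))) := by
  have hp' : 0 < ‖p‖ := norm_pos_iff.mpr hp
  have himg : (fun r : ℝ => r⁻¹) '' Set.Ioi 0 = Set.Ioi 0 := by
    ext r
    constructor
    · rintro ⟨q, hq, rfl⟩; exact Set.mem_Ioi.mpr (inv_pos.mpr (Set.mem_Ioi.mp hq))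
    · exact fun hr => ⟨r⁻¹, Set.mem_Ioi.mpr (inv_pos.mpr (Set.mem_Ioi.mp hr)), inv_inv r⟩
  -- The substitution `t ↦ 1 / t` turns the superposition into a gamma integral.
  rw [riesz, ← himg, lintegral_image_eq_lintegral_abs_deriv_mul (f' := fun r => -(r ^ 2)⁻¹)
    measurableSet_Ioi (fun r hr => (hasDerivAt_inv (Set.mem_Ioi.mp hr).ne').hasDerivWithinAt)
    inv_injective.injOn]
  have : ∀ r ∈ Set.Ioi (0 : ℝ), ENNReal.ofReal |-(r ^ 2)⁻¹| *
      (ENNReal.ofReal ((r⁻¹) ^ (x - 1)) * ENNReal.ofReal (heat r⁻¹ p)) =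
      ENNReal.ofReal (Real.pi ^ (-(3 / 2) : ℝ)) *
        ENNReal.ofReal (r ^ ((3 / 2 - x) - 1) * Real.exp (-(‖p‖ ^ 2 * r))) := by
    intro r hr
    have hr : 0 < r := hr
    rw [← ENNReal.ofReal_mul (by positivity), ← ENNReal.ofReal_mul (by positivity),
      ← ENNReal.ofReal_mul (by positivity)]
    congr 1
    rw [heat, Real.mul_rpow Real.pi_pos.le (by positivity), Real.inv_rpow hr.le,
      Real.inv_rpow hr.le, abs_neg, abs_of_pos (by positivity), ← Real.rpow_neg hr.le,
      ← Real.rpow_neg hr.le, ← Real.rpow_natCast, ← Real.rpow_neg hr.le,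
      show (3 / 2 - x) - 1 = -((2 : ℕ) : ℝ) + -(x - 1) + -(-(3 / 2)) by push_cast; ring,
      Real.rpow_add hr, Real.rpow_add hr, div_inv_eq_mul, neg_mul]
    ring
  rw [setLIntegral_congr_fun measurableSet_Ioi this, lintegral_const_mul _ (by fun_prop),
    lintegral_rpow_mul_exp_neg_mul (by linarith) (by positivity), ← ENNReal.ofReal_mul
    (by positivity)]
  congr 3
  rw [← Real.rpow_natCast, ← Real.rpow_mul hp'.le]
  congr 1
  push_cast
  ring

/-! ### A weighted Schur test -/

lemma coe_mul_coe_le_weighted (a b : NNReal) {v w : ℝ≥0∞} (hv : v ≠ 0) (hv' : v ≠ ∞)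
    (hw : w ≠ 0) (hw' : w ≠ ∞) :
    (a : ℝ≥0∞) * b ≤ 2⁻¹ * ((a : ℝ≥0∞) ^ 2 * (w / v) + (b : ℝ≥0∞) ^ 2 * (v / w)) := by
  lift v to NNReal using hv'
  lift w to NNReal using hw'
  have hv0 : v ≠ 0 := by simpa using hv
  have hw0 : w ≠ 0 := by simpa using hw
  rw [← ENNReal.coe_div hv0, ← ENNReal.coe_div hw0,
    show (2⁻¹ : ℝ≥0∞) = ((2⁻¹ : NNReal) : ℝ≥0∞) by simp]
  norm_cast
  rw [← NNReal.coe_le_coe]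
  push_cast
  have h1 : 0 < (v : ℝ) := by positivity
  have h2 : 0 < (w : ℝ) := by positivity
  have h : (2 : ℝ)⁻¹ * (a ^ 2 * (w / v) + b ^ 2 * (v / w)) - a * b =
      (a * w - b * v) ^ 2 / (2 * (v * w)) := by field_simp; ring
  have : (0 : ℝ) ≤ (a * w - b * v) ^ 2 / (2 * (v * w)) := by positivity
  linarith

lemma riesz_ne_zero_ne_top {x : ℝ} (hx : x < 3 / 2) {p : R3} (hp : p ≠ 0) :
    riesz x p ≠ 0 ∧ riesz x p ≠ ∞ := by
  have hp' : 0 < ‖p‖ := norm_pos_iff.mpr hp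
  have hG : 0 < Real.Gamma (3 / 2 - x) := Real.Gamma_pos_of_pos (by linarith)
  rw [riesz_eq hx hp]
  refine ⟨?_, ENNReal.ofReal_ne_top⟩
  rw [Ne, ENNReal.ofReal_eq_zero, not_le]
  positivity

/-- Schur test for the Riesz kernel with the weight `riesz x`: on account of the convolution law,
the test produces the explicit multiplier on the right. -/
lemma lintegral_lintegral_mul_riesz_le {x y : ℝ} (hx : 0 < x) (hx' : x < 3 / 2) (hy : 0 < y)
    {u : R3 → NNReal} (hu : Measurable u) :
    ∫⁻ p, ∫⁻ q, (u p : ℝ≥0∞) * u q * riesz y (p - q) ≤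
      ∫⁻ p, (u p : ℝ≥0∞) ^ 2 *
        (ENNReal.ofReal (ProbabilityTheory.beta y x) * riesz (x + y) p / riesz x p) := by
  set J : R3 → R3 → ℝ≥0∞ := fun p q =>
    (u p : ℝ≥0∞) ^ 2 * (riesz x p)⁻¹ * (riesz y (p - q) * riesz x q) with hJ
  have hJm : Measurable (Function.uncurry J) := by
    simp only [hJ, Function.uncurry_def]; fun_prop
  have hJint : ∫⁻ p, ∫⁻ q, J p q = ∫⁻ p, (u p : ℝ≥0∞) ^ 2 *
        (ENNReal.ofReal (ProbabilityTheory.beta y x) * riesz (x + y) p / riesz x p) := by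
    refine lintegral_congr fun p => ?_
    simp only [hJ]
    rw [lintegral_const_mul _ (by fun_prop), lintegral_riesz_mul_riesz hx hy, div_eq_mul_inv]
    ring
  have hbound : ∀ᵐ p : R3, ∀ᵐ q : R3, (u p : ℝ≥0∞) * u q * riesz y (p - q) ≤
      2⁻¹ * (J p q + J q p) := by
    filter_upwards [ae_ne_zero] with p hp
    filter_upwards [ae_ne_zero] with q hq
    obtain ⟨h1, h2⟩ := riesz_ne_zero_ne_top hx' hp
    obtain ⟨h3, h4⟩ := riesz_ne_zero_ne_top hx' hq
    refine (mul_le_mul_left (coe_mul_coe_le_weighted (u p) (u q) h1 h2 h3 h4) _).trans_eq ?_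
    simp only [hJ]
    rw [← neg_sub p q, riesz_neg, div_eq_mul_inv, div_eq_mul_inv]
    ring
  calc _ ≤ ∫⁻ p, ∫⁻ q, 2⁻¹ * (J p q + J q p) := by
        refine lintegral_mono_ae ?_
        filter_upwards [hbound] with p hp
        exact lintegral_mono_ae hp
    _ = 2⁻¹ * ((∫⁻ p, ∫⁻ q, J p q) + ∫⁻ p, ∫⁻ q, J q p) := by
        have hJ1 : ∀ p, Measurable (J p) := fun p => hJm.comp measurable_prodMk_left
        simp_rw [lintegral_const_mul' _ _ (by simp : (2⁻¹ : ℝ≥0∞) ≠ ∞)]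
        congr 1
        rw [← lintegral_add_left hJm.lintegral_prod_right]
        exact lintegral_congr fun p => lintegral_add_left (hJ1 p) _
    _ = ∫⁻ p, ∫⁻ q, J p q := by
        rw [lintegral_lintegral_swap (f := fun p q => J q p)
          (hJm.comp measurable_swap).aemeasurable, ← two_mul, ← mul_assoc,
          ENNReal.inv_mul_cancel (by simp) (by simp), one_mul]
    _ = _ := hJint

/-! ### Gaussian weights in Fourier space -/

section Gaussian

open FourierTransform SchwartzMap
open scoped RealInnerProductSpace

variable {F : Type*} [NormedAddCommGroup F] [InnerProductSpace ℂ F] [CompleteSpace F]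

/-- Multiplication by a Gaussian becomes convolution with the heat kernel. -/
lemma fourier_gaussian_smul {t : ℝ} (ht : 0 < t) (f : 𝓢(R3, F)) (p : R3) :
    𝓕 (fun x => ((Real.exp (-(Real.pi ^ 2 * t) * ‖x‖ ^ 2) : ℝ) : ℂ) • f x) p =
      ∫ q, ((heat t (p - q) : ℝ) : ℂ) • 𝓕 f q := by
  have hpi := Real.pi_pos
  set b : ℂ := ((Real.pi ^ 2 * t : ℝ) : ℂ) with hb
  have hbre : 0 < b.re := by rw [hb, Complex.ofReal_re]; positivity
  set u : R3 → ℂ := fun v => Complex.exp (-b * ‖v‖ ^ 2 + 2 * Real.pi * Complex.I * ⟪p, v⟫) with hu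
  have hui : Integrable u :=
    GaussianFourier.integrable_cexp_neg_mul_sq_norm_add hbre _ p
  have hfu : ∀ q, 𝓕 u q = ((heat t (p - q) : ℝ) : ℂ) := by
    intro q
    have h1 : (Real.pi : ℂ) / b = ((Real.pi * t : ℝ) : ℂ)⁻¹ := by
      rw [hb]; push_cast; field_simp
    have h2 : -(Real.pi : ℂ) ^ 2 * (‖p - q‖ : ℂ) ^ 2 / b =
        ((-‖p - q‖ ^ 2 / t : ℝ) : ℂ) := by
      rw [hb]; push_cast; field_simp
    rw [hu, fourier_gaussian_innerProductSpace' hbre, finrank_euclideanSpace_fin, heat, h1, h2,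
      ← Complex.ofReal_inv, show (((3 : ℕ) : ℂ) / 2) = ((3 / 2 : ℝ) : ℂ) by push_cast; ring,
      ← Complex.ofReal_cpow (by positivity), ← Complex.ofReal_exp, ← Complex.ofReal_mul,
      Real.rpow_neg (by positivity), Real.inv_rpow (by positivity)]
  have hflip : ∫ q, 𝓕 u q • 𝓕 f q = ∫ x, u x • 𝓕 (𝓕 (f : R3 → F)) x := by
    have := VectorFourier.integral_fourierIntegral_smul_eq_flip (L := innerₗ R3)
      Real.continuous_fourierChar continuous_inner hui ((𝓕 f).integrable (μ := volume))
    rw [flip_innerₗ] at this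
    exact this
  have hinv : ∀ x, 𝓕 (𝓕 (f : R3 → F)) x = f (-x) := by
    intro x
    have h := congrArg (fun g : 𝓢(R3, F) => g (-x)) (fourierInv_fourier_eq (F := 𝓢(R3, F)) f)
    simp only [fourierInv_coe, fourier_coe] at h
    rw [← h, Real.fourierInv_eq_fourier_neg, neg_neg]
  simp_rw [← hfu]
  rw [hflip, Real.fourier_eq, ← integral_neg_eq_self]
  refine integral_congr_ae (ae_of_all _ fun x => ?_)
  simp only [hinv, hu, norm_neg, inner_neg_left, neg_neg, Circle.smul_def, Real.fourierChar_apply]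
  rw [smul_smul, Complex.ofReal_exp, ← Complex.exp_add, real_inner_comm x p]
  congr 2
  rw [hb]
  push_cast
  ring

/-- The Gaussian quadratic form of `f` is, in Fourier space, the quadratic form of the heat kernel;
it is bounded by taking norms inside the double integral. -/
lemma lintegral_gaussian_mul_le {t : ℝ} (ht : 0 < t) (f : 𝓢(R3, F)) :
    ∫⁻ x, ENNReal.ofReal (Real.exp (-(Real.pi ^ 2 * t) * ‖x‖ ^ 2)) * ‖f x‖ₑ ^ 2 ≤
      ∫⁻ p, ∫⁻ q, ‖𝓕 f p‖ₑ * ‖𝓕 f q‖ₑ * ENNReal.ofReal (heat t (p - q)) := by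
  set G : R3 → ℝ := fun x => Real.exp (-(Real.pi ^ 2 * t) * ‖x‖ ^ 2) with hG
  have hG1 : ∀ x, ‖((G x : ℝ) : ℂ)‖ ≤ 1 := by
    intro x
    rw [Complex.norm_real, Real.norm_of_nonneg (Real.exp_pos _).le, Real.exp_le_one_iff]
    have : 0 ≤ Real.pi ^ 2 * t * ‖x‖ ^ 2 := by positivity
    linarith
  have hGf : Integrable fun x => ((G x : ℝ) : ℂ) • f x :=
    f.integrable.bdd_smul 1 (by simp only [hG]; fun_prop) (ae_of_all _ hG1)
  have hflip : ∫ p, inner ℂ (𝓕 (fun x => ((G x : ℝ) : ℂ) • f x) p) (𝓕 f p) =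
      ∫ x, inner ℂ (((G x : ℝ) : ℂ) • f x) (f x) := by
    have h := VectorFourier.integral_sesq_fourierIntegral_eq_neg_flip (innerSL ℂ (E := F))
      (L := innerₗ R3) Real.continuous_fourierChar continuous_inner hGf
      ((𝓕 f).integrable (μ := volume))
    have h2 : ∀ x, VectorFourier.fourierIntegral Real.fourierChar volume (-(innerₗ R3).flip)
        ((𝓕 f : 𝓢(R3, F)) : R3 → F) x = f x := by
      intro x
      have h3 := congrArg (fun g : 𝓢(R3, F) => g x) (fourierInv_fourier_eq (F := 𝓢(R3, F)) f)
      simp only [fourierInv_coe] at h3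
      rw [← h3, flip_innerₗ]
      rfl
    simp only [h2] at h
    exact h
  have hpt : ∀ x, inner ℂ (((G x : ℝ) : ℂ) • f x) (f x) = ((G x * ‖f x‖ ^ 2 : ℝ) : ℂ) := by
    intro x
    rw [inner_smul_left, Complex.conj_ofReal, inner_self_eq_norm_sq_to_K]
    push_cast
    rfl
  have hint : Integrable fun x => G x * ‖f x‖ ^ 2 :=
    ((f.memLp 2 (μ := volume)).integrable_norm_pow two_ne_zero).bdd_smul (φ := G) 1
      (by simp only [hG]; fun_prop) (ae_of_all _ fun x => by simpa using hG1 x)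
  calc ∫⁻ x, ENNReal.ofReal (G x) * ‖f x‖ₑ ^ 2
      = ENNReal.ofReal (∫ x, G x * ‖f x‖ ^ 2) := by
        rw [ofReal_integral_eq_lintegral_ofReal hint
          (ae_of_all _ fun x => mul_nonneg (Real.exp_pos _).le (sq_nonneg _))]
        refine lintegral_congr fun x => ?_
        rw [ENNReal.ofReal_mul (Real.exp_pos _).le, ENNReal.ofReal_pow (norm_nonneg _),
          ofReal_norm]
    _ = ‖∫ p, inner ℂ (𝓕 (fun x => ((G x : ℝ) : ℂ) • f x) p) (𝓕 f p)‖ₑ := by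
        rw [hflip]
        simp_rw [hpt]
        rw [integral_complex_ofReal, ← ofReal_norm, Complex.norm_real, Real.norm_of_nonneg
          (integral_nonneg fun x => mul_nonneg (Real.exp_pos _).le (sq_nonneg _))]
    _ ≤ ∫⁻ p, ‖inner ℂ (𝓕 (fun x => ((G x : ℝ) : ℂ) • f x) p) (𝓕 f p)‖ₑ :=
        enorm_integral_le_lintegral_enorm _
    _ ≤ _ := by
        refine lintegral_mono fun p => ?_
        have h1 : ‖𝓕 (fun x => ((G x : ℝ) : ℂ) • f x) p‖ₑ ≤
            ∫⁻ q, ‖𝓕 f q‖ₑ * ENNReal.ofReal (heat t (p - q)) := by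
          rw [fourier_gaussian_smul ht]
          refine (enorm_integral_le_lintegral_enorm _).trans (lintegral_mono fun q => ?_)
          rw [enorm_smul, mul_comm, ← ofReal_norm ((heat t (p - q) : ℝ) : ℂ), Complex.norm_real,
            Real.norm_of_nonneg (heat_nonneg ht _)]
        simp_rw [mul_assoc]
        rw [lintegral_const_mul' _ _ enorm_ne_top]
        calc _ ≤ ‖𝓕 (fun x => ((G x : ℝ) : ℂ) • f x) p‖ₑ * ‖𝓕 f p‖ₑ := by
              rw [← ofReal_norm, ← ofReal_norm, ← ofReal_norm, ← ENNReal.ofReal_mul (norm_nonneg _)]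
              exact ENNReal.ofReal_le_ofReal (norm_inner_le_norm _ _)
          _ ≤ _ := by
              rw [mul_comm]
              gcongr

end Gaussian

/-! ### Herbst's inequality -/

lemma constM_pos {κ : ℝ} (h0 : 0 < κ) (h1 : κ ≤ 1) : 0 < constM κ := by
  have := Real.Gamma_pos_of_pos (by linarith : 0 < 3 / 4 - κ / 2)
  have := Real.Gamma_pos_of_pos (by linarith : 0 < 3 / 4 + κ / 2)
  unfold constM
  positivity

/-- The Schur constant for the weight `riesz (3 / 4 - κ / 2)` is the constant of Herbst's
inequality. -/
lemma beta_mul_riesz_div_riesz {κ : ℝ} (h0 : 0 < κ) (h1 : κ ≤ 1) {p : R3} (hp : p ≠ 0) :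
    ENNReal.ofReal (Real.pi ^ (2 * κ) * (Real.Gamma κ)⁻¹) *
      (ENNReal.ofReal (ProbabilityTheory.beta κ (3 / 4 - κ / 2)) *
        riesz (3 / 4 - κ / 2 + κ) p / riesz (3 / 4 - κ / 2) p) =
      ENNReal.ofReal (constM κ ^ 2) * ENNReal.ofReal ((2 * Real.pi * ‖p‖) ^ (2 * κ)) := by
  have hp' : 0 < ‖p‖ := norm_pos_iff.mpr hp
  have hpi := Real.pi_pos
  have hc := constM_pos h0 h1
  have hG := Real.Gamma_pos_of_pos h0
  have hGa := Real.Gamma_pos_of_pos (by linarith : 0 < 3 / 4 - κ / 2)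
  have hGb := Real.Gamma_pos_of_pos (by linarith : 0 < 3 / 4 + κ / 2)
  have hB := ProbabilityTheory.beta_pos h0 (by linarith : 0 < 3 / 4 - κ / 2)
  have ea : 3 / 2 - (3 / 4 - κ / 2 + κ) = 3 / 4 - κ / 2 := by ring
  have eb : 3 / 2 - (3 / 4 - κ / 2) = 3 / 4 + κ / 2 := by ring
  rw [riesz_eq (by linarith) hp, riesz_eq (by linarith) hp, ea, eb, ← ENNReal.ofReal_mul hB.le,
    ← ENNReal.ofReal_div_of_pos (by positivity), ← ENNReal.ofReal_mul (by positivity),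
    ← ENNReal.ofReal_mul (by positivity)]
  congr 1
  rw [ProbabilityTheory.beta, show κ + (3 / 4 - κ / 2) = 3 / 4 + κ / 2 by ring, constM,
    Real.mul_rpow (by positivity) hp'.le, Real.mul_rpow (by positivity) hpi.le, Real.rpow_neg
    (by positivity), show 2 * (3 / 4 - κ / 2 + κ) - 3 = (2 * (3 / 4 - κ / 2) - 3) + 2 * κ by ring,
    Real.rpow_add hp', two_mul κ, Real.rpow_add (by norm_num : (0 : ℝ) < 2), Real.rpow_add hpi,
    Real.rpow_add hp', Real.rpow_neg (by norm_num : (0 : ℝ) ≤ 2)]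
  field_simp

section Schwartz

open FourierTransform SchwartzMap

/-- Herbst's inequality for Schwartz functions, with the sharp constant. -/
lemma herbst_schwartz {F : Type*} [NormedAddCommGroup F] [InnerProductSpace ℂ F] [CompleteSpace F]
    {κ : ℝ} (h0 : 0 < κ) (h1 : κ ≤ 1) (f : 𝓢(R3, F)) :
    ∫⁻ x, ENNReal.ofReal (‖x‖ ^ (-(2 * κ))) * ‖f x‖ₑ ^ 2 ≤
      ENNReal.ofReal (constM κ ^ 2) *
        ∫⁻ p, ENNReal.ofReal ((2 * Real.pi * ‖p‖) ^ (2 * κ)) * ‖𝓕 f p‖ₑ ^ 2 := by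
  have hpi := Real.pi_pos
  have hG := Real.Gamma_pos_of_pos h0
  set c : ℝ≥0∞ := ENNReal.ofReal (Real.pi ^ (2 * κ) * (Real.Gamma κ)⁻¹) with hc
  have hc' : c ≠ ∞ := ENNReal.ofReal_ne_top
  have hfm : Measurable fun x => ‖f x‖ₑ := f.continuous.enorm.measurable
  have hFm : Measurable fun x => ‖𝓕 f x‖ₑ := (𝓕 f).continuous.enorm.measurable
  -- The potential is a superposition of Gaussians.
  have hV : ∀ x : R3, x ≠ 0 → ENNReal.ofReal (‖x‖ ^ (-(2 * κ))) =
      c * ∫⁻ t in Set.Ioi 0, ENNReal.ofReal (t ^ (κ - 1)) *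
        ENNReal.ofReal (Real.exp (-(Real.pi ^ 2 * t) * ‖x‖ ^ 2)) := by
    intro x hx
    have hx' : 0 < ‖x‖ := norm_pos_iff.mpr hx
    have h := lintegral_rpow_mul_exp_neg_mul h0 (by positivity : 0 < Real.pi ^ 2 * ‖x‖ ^ 2)
    have : ∀ t ∈ Set.Ioi (0 : ℝ), ENNReal.ofReal (t ^ (κ - 1)) *
        ENNReal.ofReal (Real.exp (-(Real.pi ^ 2 * t) * ‖x‖ ^ 2)) =
        ENNReal.ofReal (t ^ (κ - 1) * Real.exp (-(Real.pi ^ 2 * ‖x‖ ^ 2 * t))) := by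
      intro t ht
      have := Set.mem_Ioi.mp ht
      rw [← ENNReal.ofReal_mul (by positivity)]
      congr 3
      ring
    rw [setLIntegral_congr_fun measurableSet_Ioi this, h, hc,
      ← ENNReal.ofReal_mul (by positivity)]
    congr 1
    rw [Real.mul_rpow (by positivity) (by positivity), ← Real.rpow_natCast, ← Real.rpow_mul hpi.le,
      ← Real.rpow_natCast, ← Real.rpow_mul hx'.le, Real.rpow_neg hx'.le, mul_neg,
      Real.rpow_neg (by positivity), Real.rpow_neg (by positivity)]
    push_cast
    field_simp
  calc ∫⁻ x, ENNReal.ofReal (‖x‖ ^ (-(2 * κ))) * ‖f x‖ₑ ^ 2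
      = ∫⁻ x, c * ∫⁻ t in Set.Ioi 0, ENNReal.ofReal (t ^ (κ - 1)) *
          (ENNReal.ofReal (Real.exp (-(Real.pi ^ 2 * t) * ‖x‖ ^ 2)) * ‖f x‖ₑ ^ 2) := by
        refine lintegral_congr_ae ?_
        filter_upwards [ae_ne_zero] with x hx
        rw [hV x hx, mul_assoc, ← lintegral_mul_const _ (by fun_prop)]
        simp_rw [mul_assoc]
    _ = c * ∫⁻ t in Set.Ioi 0, ENNReal.ofReal (t ^ (κ - 1)) *
          ∫⁻ x, ENNReal.ofReal (Real.exp (-(Real.pi ^ 2 * t) * ‖x‖ ^ 2)) * ‖f x‖ₑ ^ 2 := by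
        rw [lintegral_const_mul' _ _ hc', lintegral_lintegral_swap (by fun_prop)]
        simp_rw [lintegral_const_mul' _ _ ENNReal.ofReal_ne_top]
    _ ≤ c * ∫⁻ t in Set.Ioi 0, ENNReal.ofReal (t ^ (κ - 1)) *
          ∫⁻ p, ∫⁻ q, ‖𝓕 f p‖ₑ * ‖𝓕 f q‖ₑ * ENNReal.ofReal (heat t (p - q)) := by
        gcongr c * ?_
        refine setLIntegral_mono' measurableSet_Ioi fun t ht => ?_
        exact mul_le_mul_right (lintegral_gaussian_mul_le ht f) _
    _ = c * ∫⁻ p, ∫⁻ q, ‖𝓕 f p‖ₑ * ‖𝓕 f q‖ₑ * riesz κ (p - q) := by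
        congr 1
        have hm : Measurable fun z : (ℝ × R3) × R3 => ENNReal.ofReal (z.1.1 ^ (κ - 1)) *
            (‖𝓕 f z.1.2‖ₑ * ‖𝓕 f z.2‖ₑ * ENNReal.ofReal (heat z.1.1 (z.1.2 - z.2))) := by
          fun_prop
        simp_rw [← lintegral_const_mul' _ _ ENNReal.ofReal_ne_top]
        rw [lintegral_lintegral_swap (Measurable.lintegral_prod_right' hm).aemeasurable]
        refine lintegral_congr fun p => ?_
        rw [lintegral_lintegral_swap]
        · refine lintegral_congr fun q => ?_
          rw [riesz, ← lintegral_const_mul' _ _ (by finiteness)]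
          refine lintegral_congr fun t => ?_
          ring
        · fun_prop
    _ ≤ c * ∫⁻ p, ‖𝓕 f p‖ₑ ^ 2 * (ENNReal.ofReal (ProbabilityTheory.beta κ (3 / 4 - κ / 2)) *
        riesz (3 / 4 - κ / 2 + κ) p / riesz (3 / 4 - κ / 2) p) := by
        gcongr c * ?_
        exact lintegral_lintegral_mul_riesz_le (u := fun p => ‖𝓕 f p‖₊) (by linarith)
          (by linarith) h0 (𝓕 f).continuous.nnnorm.measurable
    _ = _ := by
        rw [← lintegral_const_mul' _ _ hc', ← lintegral_const_mul' _ _ ENNReal.ofReal_ne_top]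
        refine lintegral_congr_ae ?_
        filter_upwards [ae_ne_zero] with p hp
        rw [← mul_assoc (ENNReal.ofReal (constM κ ^ 2)), ← beta_mul_riesz_div_riesz h0 h1 hp]
        ring

end Schwartz

/-- The weight `(1 + |2 π p|²)^(1/2)`, which is the symbol of `(1 - Δ)^(1/2)`. -/
def bra (p : R3) : ℝ := √(1 + (2 * Real.pi * ‖p‖) ^ 2)

lemma one_le_bra (p : R3) : 1 ≤ bra p := by
  rw [bra, Real.one_le_sqrt]
  nlinarith [sq_nonneg (2 * Real.pi * ‖p‖)]

lemma bra_pos (p : R3) : 0 < bra p := zero_lt_one.trans_le (one_le_bra p)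

lemma bra_sq (p : R3) : bra p ^ 2 = 1 + (2 * Real.pi * ‖p‖) ^ 2 :=
  Real.sq_sqrt (by positivity)

@[fun_prop]
lemma continuous_bra : Continuous bra := by unfold bra; fun_prop

lemma rpow_le_bra_sq {κ : ℝ} (h0 : 0 < κ) (h1 : κ ≤ 1) (p : R3) :
    (2 * Real.pi * ‖p‖) ^ (2 * κ) ≤ bra p ^ 2 := by
  have h : 2 * Real.pi * ‖p‖ ≤ bra p := by
    rw [bra]
    apply Real.le_sqrt_of_sq_le
    linarith
  calc (2 * Real.pi * ‖p‖) ^ (2 * κ) ≤ bra p ^ (2 * κ) := by gcongr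
    _ ≤ bra p ^ (2 : ℝ) := Real.rpow_le_rpow_of_exponent_le (one_le_bra p) (by linarith)
    _ = _ := by norm_cast

lemma inv_bra_eq (p : R3) : (bra p)⁻¹ = (1 + ‖(2 * Real.pi) • p‖ ^ 2) ^ (-1 / 2 : ℝ) := by
  have := Real.pi_pos
  rw [bra, norm_smul, Real.norm_of_nonneg (by positivity), neg_div, Real.rpow_neg (by positivity),
    Real.sqrt_eq_rpow]

lemma hasTemperateGrowth_inv_bra :
    (fun p : R3 => (((bra p)⁻¹ : ℝ) : ℂ)).HasTemperateGrowth := by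
  simp_rw [inv_bra_eq]
  exact Complex.ofRealCLM.hasTemperateGrowth.comp
    ((Function.hasTemperateGrowth_one_add_norm_sq_rpow R3 (-1 / 2)).comp
      ((2 * Real.pi) • ContinuousLinearMap.id ℝ R3).hasTemperateGrowth)

lemma norm_inv_bra_smul_le {F : Type*} [NormedAddCommGroup F] [NormedSpace ℂ F] (p : R3) (v : F) :
    ‖(((bra p)⁻¹ : ℝ) : ℂ) • v‖ ≤ ‖v‖ := by
  rw [norm_smul, Complex.norm_real, Real.norm_of_nonneg (inv_pos.mpr (bra_pos p)).le]
  exact mul_le_of_le_one_left (norm_nonneg _) (inv_le_one_of_one_le₀ (one_le_bra p))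

lemma enorm_Lp_two_sq (h : Hrel) : ‖h‖ₑ ^ 2 = ∫⁻ p, ‖h p‖ₑ ^ 2 := by
  rw [Lp.enorm_def, eLpNorm_eq_lintegral_rpow_enorm_toReal (by norm_num) (by norm_num)]
  simp only [ENNReal.toReal_ofNat, ENNReal.rpow_ofNat]
  rw [← ENNReal.rpow_natCast, ← ENNReal.rpow_mul]
  norm_num

open Filter Topology FourierTransform SchwartzMap in
/-- Herbst's inequality on the Sobolev space of order one. -/
lemma herbst {κ : ℝ} (h0 : 0 < κ) (h1 : κ ≤ 1) {f h : Hrel}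
    (hfh : fourierRel f =ᵐ[volume] fun p => (((bra p)⁻¹ : ℝ) : ℂ) • h p) :
    ∫⁻ x, ENNReal.ofReal (‖x‖ ^ (-(2 * κ))) * ‖f x‖ₑ ^ 2 ≤
      ENNReal.ofReal (constM κ ^ 2) * ‖h‖ₑ ^ 2 := by
  have hd := SchwartzMap.denseRange_toLpCLM (E := R3) (F := Spin) (p := 2)
    (μ := (volume : Measure R3)) ENNReal.ofNat_ne_top
  obtain ⟨v, hv, hvh⟩ := mem_closure_iff_seq_limit.mp (hd h)
  choose g hg using hv
  have hgv : ∀ n, (g n).toLp 2 = v n := hg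
  set ψ : ℕ → 𝓢(R3, Spin) := fun n => smulLeftCLM Spin (fun p => (((bra p)⁻¹ : ℝ) : ℂ)) (g n)
    with hψ
  have hψp : ∀ n p, ψ n p = (((bra p)⁻¹ : ℝ) : ℂ) • g n p := fun n p =>
    smulLeftCLM_apply_apply hasTemperateGrowth_inv_bra _ _
  set φ : ℕ → 𝓢(R3, Spin) := fun n => 𝓕⁻ (ψ n) with hφ
  have hFφ : ∀ n, 𝓕 (φ n) = ψ n := fun n => fourier_fourierInv_eq (ψ n)
  -- The regularized functions converge to `f`.
  have hlim : Tendsto (fun n => (φ n).toLp 2 : ℕ → Hrel) atTop (𝓝 f) := by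
    rw [tendsto_iff_norm_sub_tendsto_zero]
    refine squeeze_zero (fun _ => norm_nonneg _) (fun n => ?_)
      (tendsto_iff_norm_sub_tendsto_zero.mp hvh)
    rw [← LinearIsometryEquiv.norm_map fourierRel, map_sub]
    have : fourierRel ((φ n).toLp 2) = (ψ n).toLp 2 := by
      rw [← hFφ n]; exact SchwartzMap.toLp_fourier_eq (φ n)
    rw [this, ← hgv n]
    refine Lp.norm_le_norm_of_ae_le ?_
    filter_upwards [Lp.coeFn_sub ((ψ n).toLp 2) (fourierRel f), Lp.coeFn_sub ((g n).toLp 2) h,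
      (ψ n).coeFn_toLp 2, (g n).coeFn_toLp 2, hfh] with p e1 e2 e3 e4 e5
    rw [e1, e2, Pi.sub_apply, Pi.sub_apply, e3, e4, e5, hψp, ← smul_sub]
    exact norm_inv_bra_smul_le p _
  -- The inequality holds for each of them.
  have hn : ∀ n, ∫⁻ x, ENNReal.ofReal (‖x‖ ^ (-(2 * κ))) * ‖φ n x‖ₑ ^ 2 ≤
      ENNReal.ofReal (constM κ ^ 2) * ‖v n‖ₑ ^ 2 := by
    intro n
    refine (herbst_schwartz h0 h1 (φ n)).trans ?_
    rw [enorm_Lp_two_sq, hFφ]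
    refine mul_le_mul_right (lintegral_mono_ae ?_) _
    filter_upwards [(g n).coeFn_toLp 2] with p hp
    rw [← hgv, hp, hψp, enorm_smul, mul_pow, ← mul_assoc]
    refine mul_le_of_le_one_left' ?_
    rw [← ofReal_norm, Complex.norm_real, Real.norm_of_nonneg (inv_pos.mpr (bra_pos p)).le,
      ← ENNReal.ofReal_pow (inv_pos.mpr (bra_pos p)).le, ← ENNReal.ofReal_mul (by positivity),
      ENNReal.ofReal_le_one, inv_pow, ← div_eq_mul_inv,
      div_le_one (pow_pos (bra_pos p) 2)]
    exact rpow_le_bra_sq h0 h1 p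
  -- Fatou's lemma along an almost everywhere convergent subsequence.
  obtain ⟨ns, hns, hae⟩ := (tendstoInMeasure_of_tendsto_Lp hlim).exists_seq_tendsto_ae
  calc ∫⁻ x, ENNReal.ofReal (‖x‖ ^ (-(2 * κ))) * ‖f x‖ₑ ^ 2
      ≤ ∫⁻ x, liminf (fun i => ENNReal.ofReal (‖x‖ ^ (-(2 * κ))) * ‖φ (ns i) x‖ₑ ^ 2) atTop := by
        refine lintegral_mono_ae ?_
        have hco : ∀ᵐ x : R3, ∀ i, ((φ (ns i)).toLp 2 : Hrel) x = φ (ns i) x :=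
          ae_all_iff.mpr fun i => (φ (ns i)).coeFn_toLp 2 volume
        filter_upwards [hae, hco] with x hx hx'
        simp_rw [hx'] at hx
        refine (Tendsto.liminf_eq ?_).ge
        exact ENNReal.Tendsto.const_mul ((ENNReal.continuous_pow 2).continuousAt.tendsto.comp
          (hx.enorm)) (Or.inr ENNReal.ofReal_ne_top)
    _ ≤ liminf (fun i => ∫⁻ x, ENNReal.ofReal (‖x‖ ^ (-(2 * κ))) * ‖φ (ns i) x‖ₑ ^ 2) atTop :=
        lintegral_liminf_le fun i => by
          have : Measurable fun x => ‖φ (ns i) x‖ₑ := (φ (ns i)).continuous.enorm.measurable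
          fun_prop
    _ ≤ liminf (fun i => ENNReal.ofReal (constM κ ^ 2) * ‖v (ns i)‖ₑ ^ 2) atTop :=
        liminf_le_liminf (Eventually.of_forall fun i => hn (ns i))
    _ = _ := by
        refine Tendsto.liminf_eq ?_
        exact ENNReal.Tendsto.const_mul ((ENNReal.continuous_pow 2).continuousAt.tendsto.comp
          ((hvh.comp hns.tendsto_atTop).enorm)) (Or.inr ENNReal.ofReal_ne_top)

/-! ### Symmetric surjective operators and their relatively bounded perturbations -/

section Abstract

variable {H : Type*} [NormedAddCommGroup H] [InnerProductSpace ℂ H] [CompleteSpace H]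

/-- A symmetric operator onto the whole space is self-adjoint. The domain is dense, since the
orthogonal complement of the domain consists of images of vectors orthogonal to the range. -/
lemma isSelfAdjoint_of_isFormalAdjoint_of_surjective {T : H →ₗ.[ℂ] H} (hs : T.IsFormalAdjoint T)
    (hsurj : ∀ g, ∃ f, T f = g) : IsSelfAdjoint T := by
  have hd : Dense (T.domain : Set H) := by
    rw [Submodule.dense_iff_topologicalClosure_eq_top, Submodule.topologicalClosure_eq_top_iff,
      Submodule.eq_bot_iff]
    intro g hg
    obtain ⟨f, rfl⟩ := hsurj g
    have hf : ∀ x : T.domain, inner ℂ (f : H) (T x) = 0 := fun x => by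
      rw [← hs f x, ← inner_conj_symm]
      simp [(Submodule.mem_orthogonal _ _).mp hg x x.2]
    obtain ⟨x, hx⟩ := hsurj f
    have h0 : f = 0 := Subtype.ext (inner_self_eq_zero.mp (hx ▸ hf x))
    rw [h0, LinearPMap.map_zero]
  rw [LinearPMap.isSelfAdjoint_def]
  refine (LinearPMap.eq_of_le_of_domain_eq (hs.le_adjoint hd) (le_antisymm
    (hs.le_adjoint hd).1 fun g hg => ?_)).symm
  obtain ⟨f, hf⟩ := hsurj (T.adjoint ⟨g, hg⟩)
  have h1 : ∀ x : T.domain, inner ℂ ((f : H) - g) (T x) = 0 := fun x => by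
    rw [inner_sub_left, ← hs f x, hf, LinearPMap.adjoint_isFormalAdjoint hd ⟨g, hg⟩ x, sub_self]
  obtain ⟨x, hx⟩ := hsurj ((f : H) - g)
  have h2 : (f : H) - g = 0 := inner_self_eq_zero.mp (hx ▸ h1 x)
  rw [← sub_eq_zero.mp h2]
  exact f.2

/-- If a symmetric operator `T` differs from a boundedly invertible operator `T₀` on the same
domain by a `T₀`-bounded operator with relative bound less than one, then `T` is self-adjoint and
boundedly invertible: `T = (1 + K) T₀` with `‖K‖ < 1`. -/
lemma isSelfAdjoint_and_zero_mem_resolventSet {T : H →ₗ.[ℂ] H} (hs : T.IsFormalAdjoint T)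
    (T₀ : T.domain →ₗ[ℂ] H) {C θ : ℝ} (hθ0 : 0 ≤ θ) (hθ : θ < 1) (hsurj : Function.Surjective T₀)
    (hC : ∀ f : T.domain, ‖(f : H)‖ ≤ C * ‖T₀ f‖) (hW : ∀ f, ‖T f - T₀ f‖ ≤ θ * ‖T₀ f‖) :
    IsSelfAdjoint T ∧ (0 : ℂ) ∈ resolventSet T := by
  have hinj : Function.Injective T₀ := by
    refine (injective_iff_map_eq_zero T₀).mpr fun f hf => ?_
    have := hC f
    rw [hf, norm_zero, mul_zero] at this
    exact Subtype.ext (norm_le_zero_iff.mp this)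
  let e : T.domain ≃ₗ[ℂ] H := LinearEquiv.ofBijective T₀ ⟨hinj, hsurj⟩
  have he' : ∀ g, T₀ (e.symm g) = g := fun g => e.apply_symm_apply g
  let R₀ : H →L[ℂ] H := LinearMap.mkContinuous (T.domain.subtype ∘ₗ (e.symm : H →ₗ[ℂ] T.domain)) C
    (fun g => by simpa [he'] using hC (e.symm g))
  -- `N = (T₀ - T) T₀⁻¹`, so that `T = (1 - N) T₀`.
  let N : H →L[ℂ] H := LinearMap.mkContinuous
    ((T₀ - T.toFun) ∘ₗ (e.symm : H →ₗ[ℂ] T.domain)) θ (fun g => by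
      have := hW (e.symm g)
      rw [he', norm_sub_rev] at this
      simpa [he'] using this)
  have hN : ‖N‖ < 1 := (LinearMap.mkContinuous_norm_le _ hθ0 _).trans_lt hθ
  let U : (H →L[ℂ] H)ˣ := Units.oneSub N hN
  have hU : ∀ g, T (e.symm g) = (U : H →L[ℂ] H) g := by
    intro g
    have h1 : (U : H →L[ℂ] H) g = g - N g := rfl
    have h2 : N g = T₀ (e.symm g) - T (e.symm g) := rfl
    rw [h1, h2, he', sub_sub_cancel]
  have hUi : ∀ g, (U : H →L[ℂ] H) ((↑U⁻¹ : H →L[ℂ] H) g) = g := fun g => by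
    rw [← mul_apply_eq_comp, Units.mul_inv, one_apply_eq_self]
  have hUi' : ∀ g, (↑U⁻¹ : H →L[ℂ] H) ((U : H →L[ℂ] H) g) = g := fun g => by
    rw [← mul_apply_eq_comp, Units.inv_mul, one_apply_eq_self]
  refine ⟨isSelfAdjoint_of_isFormalAdjoint_of_surjective hs fun g =>
    ⟨e.symm ((↑U⁻¹ : H →L[ℂ] H) g), by rw [hU, hUi]⟩, R₀ ∘L (↑U⁻¹ : H →L[ℂ] H), fun g => ?_,
    fun f => ?_⟩
  · refine ⟨(e.symm ((↑U⁻¹ : H →L[ℂ] H) g)).2, ?_⟩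
    rw [zero_smul, sub_zero]
    exact (hU _).trans (hUi g)
  · rw [zero_smul, sub_zero]
    have h1 : T f = (U : H →L[ℂ] H) (e f) := by rw [← hU, e.symm_apply_apply]
    rw [h1, ContinuousLinearMap.comp_apply, hUi']
    exact congrArg Subtype.val (e.symm_apply_apply f)

end Abstract

/-! ### The Sobolev space in Fourier space -/

lemma exists_Lp_of_norm_le {g : R3 → Spin} (hg : AEStronglyMeasurable g volume) {h : Hrel} {c : ℝ}
    (hle : ∀ᵐ p, ‖g p‖ ≤ c * ‖h p‖) : ∃ k : Hrel, k =ᵐ[volume] g :=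
  have hm : MemLp g 2 volume := (Lp.memLp h).of_le_mul hg hle
  ⟨hm.toLp g, hm.coeFn_toLp⟩

section Sobolev

open TemperedDistribution FourierTransform
open scoped SchwartzMap

/-- The Bessel weight `(1 + |p|²) ^ s`, complex valued and without the factor `2 π`, as in Mathlib's
Sobolev spaces. -/
def besselWeight (s : ℝ) (p : R3) : ℂ := (((1 + ‖p‖ ^ 2) ^ s : ℝ) : ℂ)

lemma besselWeight_temperate (s : ℝ) : (besselWeight s).HasTemperateGrowth :=
  Complex.ofRealCLM.hasTemperateGrowth.comp (Function.hasTemperateGrowth_one_add_norm_sq_rpow R3 s)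

lemma besselWeight_mul (s t : ℝ) : besselWeight s * besselWeight t = besselWeight (s + t) := by
  funext p
  simp only [besselWeight, Pi.mul_apply, Real.rpow_add (by positivity : 0 < 1 + ‖p‖ ^ 2)]
  push_cast
  rfl

lemma besselWeight_zero : besselWeight 0 = fun _ => 1 := by
  funext p; simp [besselWeight]

lemma norm_besselWeight (s : ℝ) (p : R3) : ‖besselWeight s p‖ = (1 + ‖p‖ ^ 2) ^ s := by
  rw [besselWeight, Complex.norm_real, Real.norm_of_nonneg (by positivity)]

/-- Multiplication of a tempered distribution by a Bessel weight can be undone. -/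
lemma smulLeftCLM_besselWeight_cancel (s : ℝ) (u : 𝓢'(R3, Spin)) :
    smulLeftCLM Spin (besselWeight (-s)) (smulLeftCLM Spin (besselWeight s) u) = u := by
  rw [smulLeftCLM_smulLeftCLM_apply (besselWeight_temperate _) (besselWeight_temperate _),
    besselWeight_mul]
  simp [besselWeight_zero]

lemma toTemperedDistribution_injective {f g : Hrel}
    (h : (f : 𝓢'(R3, Spin)) = (g : 𝓢'(R3, Spin))) : f = g := by
  have hk := Lp.ker_toTemperedDistributionCLM_eq_bot (F := Spin) (μ := (volume : Measure R3))
    (p := 2)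
  rw [LinearMap.ker_eq_bot] at hk
  exact hk h

/-- A negative Bessel weight acts on distributions given by `L²` functions as multiplication. -/
lemma smulLeftCLM_besselWeight_eq {s : ℝ} (hs : s ≤ 0) {f u : Hrel}
    (hfu : f =ᵐ[volume] fun p => besselWeight s p • u p) :
    (f : 𝓢'(R3, Spin)) = smulLeftCLM Spin (besselWeight s) (u : 𝓢'(R3, Spin)) := by
  have hb : MemLp (besselWeight s) ∞ (volume : Measure R3) := by
    refine memLp_top_of_bound (besselWeight_temperate s).1.continuous.aestronglyMeasurable 1
      (ae_of_all _ fun p => ?_)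
    rw [norm_besselWeight]
    exact Real.rpow_le_one_of_one_le_of_nonpos (by nlinarith [sq_nonneg ‖p‖]) hs
  rw [← Lp.toTemperedDistribution_smul_eq (r := 2) (besselWeight_temperate s) hb]
  congr 1
  refine Lp.ext ?_
  filter_upwards [hfu, Lp.coeFn_lpSMul (r := 2) (hb.toLp _) u, hb.coeFn_toLp] with p h1 h2 h3
  rw [h1, h2, Pi.smul_apply', h3]

/-- Membership in the Sobolev space of order one in terms of the weight `(1 + |2 π p|²)^(1/2)`. -/
lemma mem_sobolevOne_iff (f : Hrel) : f ∈ sobolevOne ↔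
    ∃ h : Hrel, fourierRel f =ᵐ[volume] fun p => (((bra p)⁻¹ : ℝ) : ℂ) • h p := by
  have hF : 𝓕 (f : 𝓢'(R3, Spin)) = (fourierRel f : Hrel) := Lp.fourier_toTemperedDistribution_eq f
  have hpi := Real.pi_gt_three
  have h0 : f ∈ sobolevOne ↔ ∃ u : Hrel, smulLeftCLM Spin (besselWeight (1 / 2))
      ((fourierRel f : Hrel) : 𝓢'(R3, Spin)) = (u : 𝓢'(R3, Spin)) := by
    rw [← hF]
    exact memSobolev_iff_exists_smulLeftCLM_fourier
  rw [h0]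
  have hsq : ∀ p : R3, (1 + ‖p‖ ^ 2) ^ (1 / 2 : ℝ) = √(1 + ‖p‖ ^ 2) := fun p =>
    (Real.sqrt_eq_rpow _).symm
  constructor
  · rintro ⟨u, hu⟩
    have hu' := congrArg (smulLeftCLM Spin (besselWeight (-(1 / 2)))) hu
    rw [smulLeftCLM_besselWeight_cancel] at hu'
    obtain ⟨k, hk⟩ := exists_Lp_of_norm_le (g := fun p => besselWeight (-(1 / 2)) p • u p)
      ((besselWeight_temperate _).1.continuous.aestronglyMeasurable.smul
        (Lp.aestronglyMeasurable u)) (h := u) (c := 1) (ae_of_all _ fun p => by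
        rw [norm_smul, norm_besselWeight]
        gcongr
        exact Real.rpow_le_one_of_one_le_of_nonpos (by nlinarith [sq_nonneg ‖p‖]) (by norm_num))
    have hkf : fourierRel f = k := toTemperedDistribution_injective
      (hu'.trans (smulLeftCLM_besselWeight_eq (by norm_num) hk).symm)
    obtain ⟨h, hh⟩ := exists_Lp_of_norm_le (g := fun p => ((bra p : ℝ) : ℂ) • k p)
      ((Complex.continuous_ofReal.comp continuous_bra).aestronglyMeasurable.smul
        (Lp.aestronglyMeasurable k)) (h := u) (c := 2 * Real.pi) (by
        filter_upwards [hk] with p hp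
        rw [hp, norm_smul, norm_smul, norm_besselWeight, Complex.norm_real,
          Real.norm_of_nonneg (bra_pos p).le, ← mul_assoc]
        refine mul_le_mul_of_nonneg_right ?_ (norm_nonneg _)
        rw [Real.rpow_neg (by positivity), ← div_eq_mul_inv, div_le_iff₀ (by positivity), hsq,
          bra]
        apply Real.sqrt_le_iff.mpr
        refine ⟨by positivity, ?_⟩
        rw [mul_pow _ (√_), Real.sq_sqrt (by positivity)]
        nlinarith [sq_nonneg ‖p‖])
    refine ⟨h, ?_⟩
    filter_upwards [hh] with p hp
    rw [hkf, hp, smul_smul, ← Complex.ofReal_mul, inv_mul_cancel₀ (bra_pos p).ne',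
      Complex.ofReal_one, one_smul]
  · rintro ⟨h, hh⟩
    obtain ⟨u, hu⟩ := exists_Lp_of_norm_le
      (g := fun p => besselWeight (1 / 2) p • (((bra p)⁻¹ : ℝ) : ℂ) • h p)
      ((besselWeight_temperate _).1.continuous.aestronglyMeasurable.smul
        ((hasTemperateGrowth_inv_bra).1.continuous.aestronglyMeasurable.smul
          (Lp.aestronglyMeasurable h))) (h := h) (c := 1) (ae_of_all _ fun p => by
        rw [norm_smul, norm_smul, norm_besselWeight, Complex.norm_real,
          Real.norm_of_nonneg (inv_pos.mpr (bra_pos p)).le, ← mul_assoc]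
        gcongr
        rw [← div_eq_mul_inv, div_le_one (bra_pos p), hsq, bra]
        apply Real.sqrt_le_sqrt
        have : ‖p‖ ≤ 2 * Real.pi * ‖p‖ := by nlinarith [norm_nonneg p]
        gcongr)
    refine ⟨u, ?_⟩
    rw [smulLeftCLM_besselWeight_eq (s := -(1 / 2)) (u := u) (by norm_num)]
    · simpa using smulLeftCLM_besselWeight_cancel (-(1 / 2)) (u : 𝓢'(R3, Spin))
    · filter_upwards [hh, hu] with p h1 h2
      have h3 := congrFun (besselWeight_mul (-(1 / 2)) (1 / 2)) p
      rw [neg_add_cancel, besselWeight_zero, Pi.mul_apply] at h3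
      rw [h1, h2, smul_smul (besselWeight _ p), h3, one_smul]

end Sobolev

/-! ### The symbol of the operator without potential -/

/-- The symbol `M⁻ · (2 π p) + B` of the operator without potential. -/
def sym (p : R3) : Matrix Idx16 Idx16 ℂ := MminusDot ((2 * Real.pi) • p) + matB

lemma MminusDot_smul (c : ℝ) (p : R3) : MminusDot (c • p) = (c : ℂ) • MminusDot p := by
  simp only [MminusDot, Finset.smul_sum, smul_smul]
  exact Finset.sum_congr rfl fun k _ => by simp

lemma MminusDot_conjTranspose (p : R3) : (MminusDot p)ᴴ = MminusDot p := by
  rw [MminusDot_eq, Matrix.conjTranspose_sub, Matrix.conjTranspose_kronecker,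
    Matrix.conjTranspose_kronecker, alphaDot_conjTranspose, Matrix.conjTranspose_one]

lemma dBeta_conjTranspose : dBetaᴴ = dBeta := by
  simp [dBeta, Matrix.fromBlocks_conjTranspose]

lemma dBeta_sq : dBeta * dBeta = 1 := by
  simp [dBeta, Matrix.fromBlocks_multiply, Matrix.fromBlocks_one]

lemma matB_conjTranspose : matBᴴ = matB := by
  rw [matB, Matrix.conjTranspose_smul, Matrix.conjTranspose_kronecker, dBeta_conjTranspose]
  simp

lemma matB_sq : matB * matB = (4 : ℂ) • 1 := by
  rw [matB, smul_mul_smul_comm, ← Matrix.mul_kronecker_mul, dBeta_sq, Matrix.one_kronecker_one]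
  norm_num

lemma neg_kronecker_idx4 (A B : Matrix Idx4 Idx4 ℂ) : (-A) ⊗ₖ B = -(A ⊗ₖ B) := by
  ext i j; simp [Matrix.kroneckerMap_apply]

lemma kronecker_neg_idx4 (A B : Matrix Idx4 Idx4 ℂ) : A ⊗ₖ (-B) = -(A ⊗ₖ B) := by
  ext i j; simp [Matrix.kroneckerMap_apply]

lemma MminusDot_mul_matB (p : R3) : MminusDot p * matB = -(matB * MminusDot p) := by
  simp only [MminusDot_eq, matB, sub_mul, mul_sub, mul_smul_comm, smul_mul_assoc,
    ← Matrix.mul_kronecker_mul, alphaDot_anticomm, one_mul, mul_one, neg_kronecker_idx4,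
    kronecker_neg_idx4]
  module

lemma MminusDot_sq {p : R3} (hp : p ≠ 0) :
    MminusDot p * MminusDot p = ((2 * ‖p‖ ^ 2 : ℝ) : ℂ) • (1 + tauMat p) := by
  have h : (‖p‖ : ℂ) ≠ 0 := by simpa using hp
  simp only [MminusDot_eq, sub_mul, mul_sub, ← Matrix.mul_kronecker_mul, alphaDot_sq, one_mul,
    mul_one, tauMat, Matrix.smul_kronecker, Matrix.kronecker_smul, Matrix.one_kronecker_one,
    smul_add, smul_neg, smul_smul]
  have e : ((2 * ‖p‖ ^ 2 : ℝ) : ℂ) * (((‖p‖ ^ 2)⁻¹ : ℝ) : ℂ) = 2 := by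
    push_cast; field_simp
  rw [e]
  push_cast
  module

lemma sym_conjTranspose (p : R3) : (sym p)ᴴ = sym p := by
  rw [sym, Matrix.conjTranspose_add, MminusDot_conjTranspose, matB_conjTranspose]

lemma tauMat_mul_sym {p : R3} (hp : p ≠ 0) : tauMat p * sym p = sym p * tauMat p := by
  have h1 := tauMat_mul_MminusDot hp
  have h2 : MminusDot p * tauMat p = MminusDot p := by
    have := congrArg Matrix.conjTranspose h1
    rwa [Matrix.conjTranspose_mul, MminusDot_conjTranspose, tauMat_conjTranspose] at this
  rw [sym, MminusDot_smul, mul_add, add_mul, mul_smul_comm, smul_mul_assoc, h1, h2,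
    tauMat_mul_matB]

lemma sym_mul_sym {p : R3} (hp : p ≠ 0) :
    sym p * sym p = ((2 * (2 * Real.pi * ‖p‖) ^ 2 : ℝ) : ℂ) • (1 + tauMat p) + (4 : ℂ) • 1 := by
  rw [sym, MminusDot_smul, add_mul, mul_add, mul_add, smul_mul_assoc, smul_mul_assoc,
    mul_smul_comm, mul_smul_comm, MminusDot_sq hp, MminusDot_mul_matB, matB_sq, smul_smul,
    smul_smul]
  push_cast
  module

lemma act_add (M N : Matrix Idx16 Idx16 ℂ) (v : Spin) : act (M + N) v = act M v + act N v := by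
  simp [act, map_add]

lemma act_smul (c : ℂ) (M : Matrix Idx16 Idx16 ℂ) (v : Spin) : act (c • M) v = c • act M v := by
  simp [act, map_smul]

lemma inner_act (M : Matrix Idx16 Idx16 ℂ) (hM : Mᴴ = M) (v w : Spin) :
    inner ℂ (act M v) w = inner ℂ v (act M w) := by
  rw [← ContinuousLinearMap.adjoint_inner_right, ← ContinuousLinearMap.star_eq_adjoint, act,
    ← map_star, Matrix.star_eq_conjTranspose, hM]

lemma act_sym_act_sym {p : R3} (hp : p ≠ 0) {v : Spin} (hv : act (tauMat p) v = v) :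
    act (sym p) (act (sym p) v) = ((4 * bra p ^ 2 : ℝ) : ℂ) • v := by
  rw [← act_mul, sym_mul_sym hp, act_add, act_smul, act_smul, act_add, act_one, hv, bra_sq]
  push_cast
  module

lemma norm_act_sym {p : R3} (hp : p ≠ 0) {v : Spin} (hv : act (tauMat p) v = v) :
    ‖act (sym p) v‖ = 2 * bra p * ‖v‖ := by
  have h : ‖act (sym p) v‖ ^ 2 = (2 * bra p * ‖v‖) ^ 2 := by
    rw [← inner_self_eq_norm_sq (𝕜 := ℂ), inner_act _ (sym_conjTranspose p),
      act_sym_act_sym hp hv, inner_smul_right, RCLike.re_to_complex, Complex.re_ofReal_mul,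
      ← RCLike.re_to_complex, inner_self_eq_norm_sq]
    ring
  have := bra_pos p
  exact (pow_left_inj₀ (norm_nonneg _) (by positivity) two_ne_zero).mp h

lemma act_MminusDot_apply (p : R3) (v : Spin) :
    act (MminusDot p) v = ∑ k, ((p k : ℝ) : ℂ) • act (Mminus k) v := by
  simp only [MminusDot, Fin.sum_univ_three, act_add, act_smul]

lemma norm_act_MminusDot_le (p : R3) (v : Spin) :
    ‖act (MminusDot p) v‖ ≤ (∑ k, ‖act (Mminus k)‖) * ‖p‖ * ‖v‖ := by
  rw [act_MminusDot_apply, mul_assoc, Finset.sum_mul]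
  refine norm_sum_le_of_le _ fun k _ => ?_
  rw [norm_smul, Complex.norm_real, mul_left_comm]
  exact mul_le_mul (PiLp.norm_apply_le p k) ((act (Mminus k)).le_opNorm v) (norm_nonneg _)
    (norm_nonneg _)

lemma aestronglyMeasurable_act_MminusDot {f : R3 → Spin} (hf : AEStronglyMeasurable f volume) :
    AEStronglyMeasurable (fun p => act (MminusDot ((2 * Real.pi) • p)) (f p)) volume := by
  simp only [act_MminusDot_apply]
  refine Finset.aestronglyMeasurable_fun_sum _ fun k _ => ?_
  have h : Continuous fun p : R3 => ((((2 * Real.pi) • p) k : ℝ) : ℂ) := by fun_prop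
  exact h.aestronglyMeasurable.smul ((act (Mminus k)).continuous.comp_aestronglyMeasurable hf)

lemma aestronglyMeasurable_act_sym {f : R3 → Spin} (hf : AEStronglyMeasurable f volume) :
    AEStronglyMeasurable (fun p => act (sym p) (f p)) volume := by
  simp only [sym, act_add]
  exact (aestronglyMeasurable_act_MminusDot hf).add
    ((act matB).continuous.comp_aestronglyMeasurable hf)

/-! ### The operator without potential on `P₊ Hrel` -/

lemma fourierRel_freeRel_add_opB (f : Hrel) (hf : f ∈ freeRel.domain) :
    fourierRel (freeRel ⟨f, hf⟩ + opB f) =ᵐ[volume] fun p => act (sym p) (fourierRel f p) := by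
  rw [map_add, fourierRel_opB]
  have h1 : fourierRel (freeRel ⟨f, hf⟩) =
      mulOp (fun p => act (MminusDot ((2 * Real.pi) • p))) ⟨fourierRel f, hf⟩ :=
    fourierRel.apply_symm_apply _
  rw [h1]
  filter_upwards [Lp.coeFn_add (mulOp (fun p => act (MminusDot ((2 * Real.pi) • p)))
    ⟨fourierRel f, hf⟩) (opB (fourierRel f)), mulOp_coeFn (m := fun p =>
    act (MminusDot ((2 * Real.pi) • p))) ⟨fourierRel f, hf⟩, opB_coeFn (fourierRel f)]
    with p e1 e2 e3
  rw [e1, Pi.add_apply, e2, e3, sym, act_add]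

/-- Elements of `P₊ Hrel` take values in the range of `(1 + τ(p)) / 2` in Fourier space. -/
lemma mem_Hplus_iff_ae (f : Hrel) :
    f ∈ Hplus ↔ ∀ᵐ p, act (tauMat p) (fourierRel f p) = fourierRel f p := by
  rw [mem_Hplus_iff, opTau_apply, LinearIsometryEquiv.symm_apply_eq]
  constructor
  · intro h
    have h1 := mulTau_coeFn (fourierRel f)
    rw [h] at h1
    filter_upwards [h1] with p hp using hp.symm
  · intro h
    refine Lp.ext ?_
    filter_upwards [mulTau_coeFn (fourierRel f), h] with p h1 h2
    rw [h1, h2]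

lemma sobolevOne_le_freeRel_domain {f : Hrel} (hf : f ∈ sobolevOne) : f ∈ freeRel.domain := by
  obtain ⟨h, hh⟩ := (mem_sobolevOne_iff f).mp hf
  have hpi := Real.pi_pos
  change MemLp (fun p => act (MminusDot ((2 * Real.pi) • p)) (fourierRel f p)) 2 volume
  refine (Lp.memLp h).of_le_mul (c := ∑ k, ‖act (Mminus k)‖)
    (aestronglyMeasurable_act_MminusDot (Lp.aestronglyMeasurable _)) ?_
  filter_upwards [hh] with p hp
  refine (norm_act_MminusDot_le _ _).trans ?_
  have hb := bra_pos p
  rw [hp, mul_assoc, norm_smul, norm_smul, Complex.norm_real, Real.norm_of_nonneg (by positivity),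
    Real.norm_of_nonneg (by positivity), ← mul_assoc (2 * Real.pi * ‖p‖)]
  refine mul_le_mul_of_nonneg_left (mul_le_of_le_one_left (norm_nonneg _) ?_)
    (Finset.sum_nonneg fun k _ => norm_nonneg _)
  rw [← div_eq_mul_inv, div_le_one hb, bra]
  exact Real.le_sqrt_of_sq_le (by linarith)

/-- In Fourier space the operator without potential has modulus `2 (1 + |2 π p|²)^(1/2)`. -/
lemma norm_le_half_norm_freeRel_add_opB {f h : Hrel} (hf : f ∈ Hplus) (hd : f ∈ freeRel.domain)
    (hh : fourierRel f =ᵐ[volume] fun p => (((bra p)⁻¹ : ℝ) : ℂ) • h p) :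
    ‖h‖ ≤ 1 / 2 * ‖freeRel ⟨f, hd⟩ + opB f‖ := by
  rw [← LinearIsometryEquiv.norm_map fourierRel (freeRel ⟨f, hd⟩ + opB f)]
  refine Lp.norm_le_mul_norm_of_ae_le_mul ?_
  filter_upwards [fourierRel_freeRel_add_opB f hd, hh, (mem_Hplus_iff_ae f).mp hf, ae_ne_zero]
    with p e1 e2 e3 hp
  have hb := bra_pos p
  rw [e1, norm_act_sym hp e3, e2, norm_smul, Complex.norm_real, Real.norm_of_nonneg (by positivity)]
  apply le_of_eq
  field_simp

lemma norm_le_of_fourierRel_eq {f h : Hrel}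
    (hh : fourierRel f =ᵐ[volume] fun p => (((bra p)⁻¹ : ℝ) : ℂ) • h p) : ‖f‖ ≤ ‖h‖ := by
  rw [← LinearIsometryEquiv.norm_map fourierRel f]
  refine Lp.norm_le_norm_of_ae_le ?_
  filter_upwards [hh] with p hp
  rw [hp]
  exact norm_inv_bra_smul_le p _

/-- The operator without potential maps `D₊` onto `P₊ Hrel`: its square is
`4 (1 + |2 π p|²)` in Fourier space. -/
lemma exists_freeRel_add_opB_eq {g : Hrel} (hg : g ∈ Hplus) :
    ∃ f ∈ Hplus, f ∈ sobolevOne ∧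
      ∀ hd : f ∈ freeRel.domain, freeRel ⟨f, hd⟩ + opB f = g := by
  have hgτ := (mem_Hplus_iff_ae g).mp hg
  have hm : AEStronglyMeasurable (fun p => act (sym p) (fourierRel g p)) volume :=
    aestronglyMeasurable_act_sym (Lp.aestronglyMeasurable _)
  have hc : Continuous fun p => ((bra p : ℝ) : ℂ)⁻¹ :=
    (Complex.continuous_ofReal.comp continuous_bra).inv₀ fun p =>
      Complex.ofReal_ne_zero.mpr (bra_pos p).ne'
  obtain ⟨h, hh⟩ := exists_Lp_of_norm_le
    (g := fun p => (1 / 4 : ℂ) • ((bra p : ℝ) : ℂ)⁻¹ • act (sym p) (fourierRel g p))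
    ((hc.aestronglyMeasurable.smul hm).const_smul (1 / 4 : ℂ)) (h := fourierRel g) (c := 1 / 2) (by
      filter_upwards [hgτ, ae_ne_zero] with p hp hp0
      have hb := bra_pos p
      rw [norm_smul, norm_smul, norm_act_sym hp0 hp, norm_inv, Complex.norm_real,
        Real.norm_of_nonneg hb.le]
      apply le_of_eq
      norm_num
      field_simp
      norm_num)
  obtain ⟨k, hk⟩ := exists_Lp_of_norm_le (g := fun p => (((bra p)⁻¹ : ℝ) : ℂ) • h p)
    (hasTemperateGrowth_inv_bra.1.continuous.aestronglyMeasurable.smul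
      (Lp.aestronglyMeasurable h)) (h := h) (c := 1)
    (ae_of_all _ fun p => by rw [one_mul]; exact norm_inv_bra_smul_le p _)
  have hkg : ∀ᵐ p, k p = ((1 / (4 * bra p ^ 2) : ℝ) : ℂ) • act (sym p) (fourierRel g p) := by
    filter_upwards [hk, hh] with p h1 h2
    have hb : (bra p : ℂ) ≠ 0 := by exact_mod_cast (bra_pos p).ne'
    rw [h1, h2, smul_smul, smul_smul]
    congr 1
    push_cast
    field_simp
  refine ⟨fourierRel.symm k, ?_, ?_, fun hd => ?_⟩
  · rw [mem_Hplus_iff_ae, LinearIsometryEquiv.apply_symm_apply]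
    filter_upwards [hkg, hgτ, ae_ne_zero] with p h1 h2 hp
    rw [h1, map_smul, ← act_mul, tauMat_mul_sym hp, act_mul, h2]
  · rw [mem_sobolevOne_iff, LinearIsometryEquiv.apply_symm_apply]
    exact ⟨h, hk⟩
  · refine fourierRel.injective (Lp.ext ?_)
    have h0 := fourierRel_freeRel_add_opB _ hd
    rw [LinearIsometryEquiv.apply_symm_apply] at h0
    filter_upwards [h0, hkg, hgτ, ae_ne_zero] with p h1 h2 h3 hp
    have hb := bra_pos p
    rw [h1, h2, map_smul, act_sym_act_sym hp h3, smul_smul, ← Complex.ofReal_mul,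
      one_div_mul_cancel (by positivity), Complex.ofReal_one, one_smul]

/-! ### The potential -/

/-- On the Sobolev space of order one the potential is defined, with Herbst's bound. -/
lemma mem_potV_domain_and_norm_le {κ : ℝ} (h0 : 0 < κ) (h1 : κ ≤ 1) {f h : Hrel}
    (hh : fourierRel f =ᵐ[volume] fun p => (((bra p)⁻¹ : ℝ) : ℂ) • h p) :
    ∃ hf : f ∈ (potV κ).domain, ‖potV κ ⟨f, hf⟩‖ ≤ constM κ * ‖h‖ := by
  have hH := herbst h0 h1 hh
  have hc := constM_pos h0 h1
  have hpt : ∀ r : R3, ‖(((‖r‖ ^ (-κ) : ℝ) : ℂ) • ContinuousLinearMap.id ℂ Spin) (f r)‖ₑ ^ 2 =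
      ENNReal.ofReal (‖r‖ ^ (-(2 * κ))) * ‖f r‖ₑ ^ 2 := by
    intro r
    rw [_root_.smul_apply, ContinuousLinearMap.id_apply, enorm_smul, mul_pow,
      ← ofReal_norm, Complex.norm_real, Real.norm_of_nonneg (by positivity),
      ← ENNReal.ofReal_pow (by positivity), ← Real.rpow_mul_natCast (norm_nonneg r)]
    congr 3
    push_cast
    ring
  have hmeas : AEStronglyMeasurable (fun r : R3 =>
      (((‖r‖ ^ (-κ) : ℝ) : ℂ) • ContinuousLinearMap.id ℂ Spin) (f r)) volume := by
    have : Measurable fun r : R3 => ((‖r‖ ^ (-κ) : ℝ) : ℂ) := by fun_prop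
    exact this.aestronglyMeasurable.smul (Lp.aestronglyMeasurable f)
  have hf : f ∈ (potV κ).domain := by
    refine ⟨hmeas, ?_⟩
    rw [eLpNorm_lt_top_iff_lintegral_rpow_enorm_lt_top (by norm_num) (by norm_num)]
    simp only [ENNReal.toReal_ofNat, ENNReal.rpow_ofNat, hpt]
    exact hH.trans_lt (by finiteness)
  refine ⟨hf, ?_⟩
  have h2 : ‖potV κ ⟨f, hf⟩‖ₑ ^ 2 ≤ ENNReal.ofReal (constM κ ^ 2) * ‖h‖ₑ ^ 2 := by
    refine le_trans (le_of_eq ?_) hH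
    rw [enorm_Lp_two_sq]
    refine lintegral_congr_ae ?_
    filter_upwards [mulOp_coeFn (m := fun r : R3 => ((‖r‖ ^ (-κ) : ℝ) : ℂ) •
      ContinuousLinearMap.id ℂ Spin) ⟨f, hf⟩] with r hr
    rw [← hpt, ← hr]
    rfl
  rw [← ofReal_norm, ← ofReal_norm, ← ENNReal.ofReal_pow (norm_nonneg _),
    ← ENNReal.ofReal_pow (norm_nonneg _), ← ENNReal.ofReal_mul (by positivity),
    ENNReal.ofReal_le_ofReal_iff (by positivity), ← mul_pow] at h2
  exact (pow_le_pow_iff_left₀ (norm_nonneg _) (by positivity) two_ne_zero).mp h2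

/-! ### Symmetry -/

lemma inner_eq_inner_of_ae {f g f' g' : Hrel}
    (h : ∀ᵐ p, inner ℂ (f' p) (g p) = inner ℂ (f p) (g' p)) : inner ℂ f' g = inner ℂ f g' := by
  rw [L2.inner_def, L2.inner_def]
  exact integral_congr_ae h

lemma inner_opTau (f g : Hrel) : inner ℂ (opTau f) g = inner ℂ f (opTau g) := by
  rw [← LinearIsometryEquiv.inner_map_map fourierRel (opTau f),
    ← LinearIsometryEquiv.inner_map_map fourierRel f, opTau_apply, opTau_apply,
    LinearIsometryEquiv.apply_symm_apply, LinearIsometryEquiv.apply_symm_apply]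
  refine inner_eq_inner_of_ae ?_
  filter_upwards [mulTau_coeFn (fourierRel f), mulTau_coeFn (fourierRel g)] with p h1 h2
  rw [h1, h2, inner_act _ (tauMat_conjTranspose p)]

lemma inner_Pplus (f g : Hrel) : inner ℂ (Pplus f) g = inner ℂ f (Pplus g) := by
  rw [Pplus_apply, Pplus_apply, inner_smul_left, inner_smul_right, inner_add_left, inner_add_right,
    inner_opTau]
  congr 1
  simp only [map_div₀, map_one, Complex.conj_ofNat]

lemma Pplus_eq_self {f : Hrel} (hf : f ∈ Hplus) : Pplus f = f := by
  rw [Pplus_apply, (mem_Hplus_iff f).mp hf, ← two_smul ℂ f, smul_smul]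
  norm_num

lemma norm_Pplus_le (f : Hrel) : ‖Pplus f‖ ≤ ‖f‖ := by
  have h1 : ‖opTau f‖ ≤ ‖f‖ := by
    rw [opTau_apply, LinearIsometryEquiv.norm_map, ← LinearIsometryEquiv.norm_map fourierRel f]
    refine Lp.norm_le_norm_of_ae_le ?_
    filter_upwards [mulTau_coeFn (fourierRel f)] with p hp
    rw [hp]
    exact ((act (tauMat p)).le_of_opNorm_le (norm_act_tauMat_le p) _).trans_eq (one_mul _)
  rw [Pplus_apply, norm_smul]
  have h2 := norm_add_le f (opTau f)
  norm_num
  linarith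

lemma inner_freeRel_add_opB (f g : Hrel) (hf : f ∈ freeRel.domain) (hg : g ∈ freeRel.domain) :
    inner ℂ (freeRel ⟨f, hf⟩ + opB f) g = inner ℂ f (freeRel ⟨g, hg⟩ + opB g) := by
  rw [← LinearIsometryEquiv.inner_map_map fourierRel _ g,
    ← LinearIsometryEquiv.inner_map_map fourierRel f]
  refine inner_eq_inner_of_ae ?_
  filter_upwards [fourierRel_freeRel_add_opB f hf, fourierRel_freeRel_add_opB g hg] with p h1 h2
  rw [h1, h2, inner_act _ (sym_conjTranspose p)]

lemma inner_potV (κ : ℝ) (f g : (potV κ).domain) :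
    inner ℂ (potV κ f) (g : Hrel) = inner ℂ (f : Hrel) (potV κ g) := by
  refine inner_eq_inner_of_ae ?_
  filter_upwards [mulOp_coeFn (m := fun r : R3 => ((‖r‖ ^ (-κ) : ℝ) : ℂ) •
      ContinuousLinearMap.id ℂ Spin) f, mulOp_coeFn (m := fun r : R3 => ((‖r‖ ^ (-κ) : ℝ) : ℂ) •
      ContinuousLinearMap.id ℂ Spin) g] with r h1 h2
  change inner ℂ (mulOp _ f r) _ = inner ℂ _ (mulOp _ g r)
  rw [h1, h2, _root_.smul_apply, _root_.smul_apply,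
    inner_smul_left, inner_smul_right, Complex.conj_ofReal]
  rfl

/-- On `P₊ Hrel` the inner projections in the definition of `opA` act as the identity. -/
lemma opA_apply (κ γ : ℝ) (f : (opA κ γ).domain) (h1 : ((f : Hplus) : Hrel) ∈ freeRel.domain)
    (h2 : ((f : Hplus) : Hrel) ∈ (potV κ).domain) :
    ((opA κ γ f : Hplus) : Hrel) = freeRel ⟨((f : Hplus) : Hrel), h1⟩ + opB ((f : Hplus) : Hrel) +
      (γ : ℂ) • Pplus (potV κ ⟨((f : Hplus) : Hrel), h2⟩) := by
  have hP := Pplus_eq_self (f : Hplus).2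
  change freeRel ⟨((f : Hplus) : Hrel), f.2.1.2⟩ + opB (Pplus ((f : Hplus) : Hrel)) +
    Pplus ((γ : ℂ) • potV κ ⟨Pplus ((f : Hplus) : Hrel), f.2.2⟩) = _
  have h3 : (⟨Pplus ((f : Hplus) : Hrel), f.2.2⟩ : (potV κ).domain) =
      ⟨((f : Hplus) : Hrel), h2⟩ := Subtype.ext hP
  rw [h3, hP, map_smul]

lemma mem_domA_iff {κ : ℝ} (h0 : 0 < κ) (h1 : κ ≤ 1) (f : Hplus) :
    f ∈ domA κ ↔ (f : Hrel) ∈ sobolevOne := by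
  refine ⟨fun h => h.1.1, fun h => ⟨⟨h, sobolevOne_le_freeRel_domain h⟩, ?_⟩⟩
  obtain ⟨k, hk⟩ := (mem_sobolevOne_iff _).mp h
  obtain ⟨hf, -⟩ := mem_potV_domain_and_norm_le h0 h1 hk
  change Pplus (f : Hrel) ∈ (potV κ).domain
  rwa [Pplus_eq_self f.2]

lemma mem_potV_domain_of_mem_domA {κ : ℝ} {f : Hplus} (hf : f ∈ domA κ) :
    (f : Hrel) ∈ (potV κ).domain := by
  have h : Pplus (f : Hrel) ∈ (potV κ).domain := hf.2
  rwa [Pplus_eq_self f.2] at h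

lemma isFormalAdjoint_opA (κ γ : ℝ) : (opA κ γ).IsFormalAdjoint (opA κ γ) := by
  intro f g
  have hf := mem_potV_domain_of_mem_domA f.2
  have hg := mem_potV_domain_of_mem_domA g.2
  have hf' : ((f : Hplus) : Hrel) ∈ freeRel.domain := f.2.1.2
  have hg' : ((g : Hplus) : Hrel) ∈ freeRel.domain := g.2.1.2
  have h1 := inner_freeRel_add_opB _ _ hf' hg'
  have h2 := inner_potV κ ⟨_, hf⟩ ⟨_, hg⟩
  rw [Submodule.coe_inner, Submodule.coe_inner, opA_apply κ γ f hf' hf, opA_apply κ γ g hg' hg,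
    inner_add_left, inner_add_right, h1, inner_smul_left, inner_smul_right, inner_Pplus,
    ← inner_Pplus _ (potV κ _), Pplus_eq_self (f : Hplus).2, Pplus_eq_self (g : Hplus).2,
    Complex.conj_ofReal, h2]

/-- The operator without potential, on the domain of `opA κ γ` (which does not depend on `γ`). -/
def unperturbed (κ γ : ℝ) : (opA κ γ).domain →ₗ[ℂ] Hplus := (opA κ 0).toFun

lemma unperturbed_apply (κ γ : ℝ) (f : (opA κ γ).domain)
    (hd : ((f : Hplus) : Hrel) ∈ freeRel.domain) :
    (unperturbed κ γ f : Hrel) =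
      freeRel ⟨((f : Hplus) : Hrel), hd⟩ + opB ((f : Hplus) : Hrel) := by
  have h := opA_apply κ 0 f hd (mem_potV_domain_of_mem_domA f.2)
  rwa [Complex.ofReal_zero, zero_smul, add_zero] at h

end TwoBodyDirac
end

theorem mainTheorem6 (κ γ : ℝ) (hκ0 : 0 < κ) (hκ1 : κ ≤ 1)
    (hγ : |γ| * TwoBodyDirac.constM κ < 2) :
    (TwoBodyDirac.opA κ γ).domain = TwoBodyDirac.Dplus ∧
      IsSelfAdjoint (TwoBodyDirac.opA κ γ) ∧
      (0 : ℂ) ∈ TwoBodyDirac.resolventSet (TwoBodyDirac.opA κ γ) := by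
  open TwoBodyDirac in
  have hc := constM_pos hκ0 hκ1
  have hd : ∀ f : (opA κ γ).domain, ((f : Hplus) : Hrel) ∈ freeRel.domain := fun f => f.2.1.2
  have hs : ∀ f : (opA κ γ).domain, ((f : Hplus) : Hrel) ∈ sobolevOne := fun f => f.2.1.1
  refine ⟨Submodule.ext fun f => mem_domA_iff hκ0 hκ1 f, ?_⟩
  refine isSelfAdjoint_and_zero_mem_resolventSet (isFormalAdjoint_opA κ γ) (unperturbed κ γ)
    (C := 1 / 2) (θ := |γ| * constM κ / 2) (by positivity) (by linarith) (fun g => ?_)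
    (fun f => ?_) (fun f => ?_)
  · obtain ⟨f, hf, hfs, hfg⟩ := exists_freeRel_add_opB_eq g.2
    have hfd : (⟨f, hf⟩ : Hplus) ∈ domA κ := (mem_domA_iff hκ0 hκ1 _).mpr hfs
    have hfree := sobolevOne_le_freeRel_domain hfs
    refine ⟨⟨⟨f, hf⟩, hfd⟩, Subtype.ext ?_⟩
    rw [unperturbed_apply κ γ ⟨⟨f, hf⟩, hfd⟩ hfree]
    exact hfg hfree
  · obtain ⟨h, hh⟩ := (mem_sobolevOne_iff _).mp (hs f)
    rw [Submodule.coe_norm, Submodule.coe_norm, unperturbed_apply κ γ f (hd f)]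
    exact (norm_le_of_fourierRel_eq hh).trans
      (norm_le_half_norm_freeRel_add_opB (f : Hplus).2 (hd f) hh)
  · obtain ⟨h, hh⟩ := (mem_sobolevOne_iff _).mp (hs f)
    obtain ⟨hV, hVn⟩ := mem_potV_domain_and_norm_le hκ0 hκ1 hh
    have hn := norm_le_half_norm_freeRel_add_opB (f : Hplus).2 (hd f) hh
    rw [Submodule.coe_norm, Submodule.coe_norm, Submodule.coe_sub, unperturbed_apply κ γ f (hd f),
      opA_apply κ γ f (hd f) hV, add_sub_cancel_left, norm_smul, Complex.norm_real,
      Real.norm_eq_abs]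
    calc |γ| * ‖Pplus (potV κ ⟨((f : Hplus) : Hrel), hV⟩)‖
        ≤ |γ| * (constM κ * (1 / 2 * ‖freeRel ⟨((f : Hplus) : Hrel), hd f⟩ +
            opB ((f : Hplus) : Hrel)‖)) := by
          gcongr
          exact (norm_Pplus_le _).trans (hVn.trans (by gcongr))
      _ = _ := by ring
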